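/- Let $n\ge 1$ and let $\mathbb{D}^n=\{z\in\mathbb{C}^n: |z_j|<1,\ j=1,\dots,n\}$ be the unit polydisc. For $1\le r\le\infty$ let $L^r_c(\mathbb{D}^n)$ be the space of functions in $L^r(\mathbb{D}^n)$ (with respect to Lebesgue measure) that vanish almost everywhere outside some compact subset of $\mathbb{D}^n$. A $(0,q)$-current on $\mathbb{D}^n$ is a sum $T=\sum_{|J|=q}T_J\,d\bar z_J$ over increasing multi-indices, with distributions $T_J$ on $\mathbb{D}^n$ as coefficients; $\bar\partial T=\sum_J\sum_k \frac{\partial T_J}{\partial\bar z_k}\,d\bar z_k\wedge d\bar z_J$ in the sense of distributions. A form with $L^r$ coefficients is regarded as a current, and its norm $\|\cdot\|_r$ is the maximum of the $L^r(\mathbb{D}^n)$ norms of its coefficients. **Theorem.** (1) Let $1\le r\le\infty$ and let $\omega$ be a $(0,n)$-form with coefficients in $L^r_c(\mathbb{D}^n)$. If there is a $(0,n-1)$-current $T$ with compact support in $\mathbb{D}^n$ such that $\bar\partial T=\omega$, then there is a $(0,n-1)$-form $\eta$ with coefficients in $L^r_c(\mathbb{D}^n)$ such that $\bar\partial\eta=\omega$.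 (2) The solution can be given by a bounded linear operator, in the following sense. For every compact set $K\subset\mathbb{D}^n$ there are a compact set $K'\subset\mathbb{D}^n$ and a constant $C$, both depending only on $n$ and $K$, such that for every $1\le r\le\infty$ there is a linear operator $S$, defined on the space of all $(0,n)$-forms $\omega$ with $L^r$ coefficients supported in $K$ for which $\bar\partial T=\omega$ has a solution $T$ that is a $(0,n-1)$-current with compact support in $\mathbb{D}^n$, such that for each such $\omega$ the $(0,n-1)$-form $S\omega$ has $L^r$ coefficients supported in $K'$, $\bar\partial(S\omega)=\omega$, and $\|S\omega\|_r\le C\|\omega\|_r$. -/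

import Mathlib

open MeasureTheory TopologicalSpace
open scoped ENNReal Distributions LineDeriv

noncomputable section

namespace DbarPolydisc

/-- The unit polydisc `𝔻ⁿ` of `ℂⁿ`, as an open set. -/
def polydisc (n : ℕ) : Opens (Fin n → ℂ) where
  carrier := {z | ∀ j, ‖z j‖ < 1}
  is_open' := by
    simp only [Set.ofPred_forall]
    exact isOpen_iInter_of_finite fun j =>
      isOpen_lt (continuous_apply j).norm continuous_const

/-- Increasing multi-indices `J = (j₁ < ⋯ < j_q)` in `{0, …, n-1}`, encoded by their sets of
entries. The form `dz̄_J = dz̄_{j₁} ∧ ⋯ ∧ dz̄_{j_q}` is the basis form attached to `J`. -/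
abbrev MultiIndex (n q : ℕ) : Type := {J : Finset (Fin n) // J.card = q}

/-- The multi-index `I ∖ {k}`, for an entry `k` of `I`. -/
def MultiIndex.erase {n q : ℕ} (I : MultiIndex n (q + 1)) (k : Fin n) (hk : k ∈ I.1) :
    MultiIndex n q :=
  ⟨I.1.erase k, by rw [Finset.card_erase_of_mem hk, I.2]; rfl⟩

variable {n q : ℕ}

/-- The Cauchy-Riemann operator `∂/∂z̄_k = (∂/∂x_k + i ∂/∂y_k) / 2` on complex distributions. -/
def dbarCoord (Ω : Opens (Fin n → ℂ)) (k : Fin n) : 𝓓'(Ω, ℂ) →ₗ[ℂ] 𝓓'(Ω, ℂ) where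
  toFun T := (1 / 2 : ℂ) •
    (∂_{(Pi.single k 1 : Fin n → ℂ)} T + Complex.I • ∂_{(Pi.single k Complex.I : Fin n → ℂ)} T)
  map_add' S T := by
    simp only [LineDeriv.lineDerivOp_add, smul_add]; abel
  map_smul' c T := by
    ext φ
    simp
    ring

/-- `(0,q)`-currents on `Ω`: formal sums `∑_{|J| = q} T_J dz̄_J` with distributions `T_J` on `Ω`
as coefficients. -/
abbrev Current (Ω : Opens (Fin n → ℂ)) (q : ℕ) : Type := MultiIndex n q → 𝓓'(Ω, ℂ)

/-- The operator `∂̄ (∑_J T_J dz̄_J) = ∑_J ∑_k (∂T_J/∂z̄_k) dz̄_k ∧ dz̄_J`. Its coefficient at `I`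
collects the pairs `k ∈ I`, `J = I ∖ {k}`, for which
`dz̄_k ∧ dz̄_J = (-1) ^ #{i ∈ I | i < k} dz̄_I`. -/
def dbar (Ω : Opens (Fin n → ℂ)) (q : ℕ) : Current Ω q →ₗ[ℂ] Current Ω (q + 1) where
  toFun T I := ∑ k : {k // k ∈ I.1},
    (-1 : ℂ) ^ (I.1.filter (· < k.1)).card • dbarCoord Ω k.1 (T (I.erase k.1 k.2))
  map_add' S T := by
    funext I
    simp only [Pi.add_apply, map_add, smul_add, Finset.sum_add_distrib]
  map_smul' c T := by
    funext I
    simp only [Pi.smul_apply, map_smul, RingHom.id_apply, Finset.smul_sum]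
    exact Finset.sum_congr rfl fun k _ => smul_comm _ _ _

/-- A current on `Ω` has compact support in `Ω` if its coefficients vanish off a compact subset
of `Ω`. -/
def Current.HasCompactSupport {Ω : Opens (Fin n → ℂ)} (T : Current Ω q) : Prop :=
  ∃ K : Set (Fin n → ℂ), IsCompact K ∧ K ⊆ Ω ∧ ∀ J, Distribution.IsVanishingOn (T J) Kᶜ

/-- `(0,q)`-forms on `Ω` with coefficients in `L^r(Ω)`. The norm of a form is the maximum of the
`L^r` norms of its coefficients. -/
abbrev LpForm (Ω : Opens (Fin n → ℂ)) (q : ℕ) (r : ℝ≥0∞) : Type :=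
  MultiIndex n q → Lp ℂ r (volume.restrict (Ω : Set (Fin n → ℂ)))

/-- The `(0,q)`-forms with `L^r(Ω)` coefficients that vanish (almost everywhere) off `K`. -/
def LpForm.supportedIn (Ω : Opens (Fin n → ℂ)) (q : ℕ) (r : ℝ≥0∞) (K : Set (Fin n → ℂ)) :
    Submodule ℂ (LpForm Ω q r) where
  carrier := {ω | ∀ J, ∀ᵐ z ∂volume.restrict (Ω : Set (Fin n → ℂ)), z ∉ K → ω J z = 0}
  zero_mem' J := by
    filter_upwards [Lp.coeFn_zero ℂ r (volume.restrict (Ω : Set (Fin n → ℂ)))] with z hz _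
    exact hz
  add_mem' {ω η} hω hη J := by
    filter_upwards [hω J, hη J, Lp.coeFn_add (ω J) (η J)] with z h₁ h₂ h₃ hz
    rw [Pi.add_apply, h₃, Pi.add_apply, h₁ hz, h₂ hz, add_zero]
  smul_mem' c ω hω J := by
    filter_upwards [hω J, Lp.coeFn_smul c (ω J)] with z h₁ h₂ hz
    rw [Pi.smul_apply, h₂, Pi.smul_apply, h₁ hz, smul_zero]

/-- The coefficients of the form are in `L^r_c(Ω)`: they are in `L^r(Ω)` and vanish off a compact
subset of `Ω`. -/
def LpForm.HasCompactSupport {Ω : Opens (Fin n → ℂ)} {r : ℝ≥0∞} (ω : LpForm Ω q r) : Prop :=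
  ∃ K : Set (Fin n → ℂ), IsCompact K ∧ K ⊆ Ω ∧ ω ∈ LpForm.supportedIn Ω q r K

/-- The distribution `φ ↦ ∫_Ω φ f` defined by a (locally integrable) function `f`. -/
def distributionOfFun (Ω : Opens (Fin n → ℂ)) (f : (Fin n → ℂ) → ℂ) : 𝓓'(Ω, ℂ) :=
  ContinuousLinearMap.toUniformConvergenceCLM _ _ _
    (TestFunction.integralAgainstBilinCLM (ContinuousLinearMap.lsmul ℝ ℝ)
      (volume.restrict (Ω : Set (Fin n → ℂ))) f)

theorem locallyIntegrable_Lp (Ω : Opens (Fin n → ℂ)) (r : ℝ≥0∞) [hr : Fact (1 ≤ r)]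
    (f : Lp ℂ r (volume.restrict (Ω : Set (Fin n → ℂ)))) :
    LocallyIntegrable f (volume.restrict (Ω : Set (Fin n → ℂ))) :=
  (Lp.memLp f).locallyIntegrable hr.out

theorem distributionOfFun_apply (Ω : Opens (Fin n → ℂ)) (r : ℝ≥0∞) [Fact (1 ≤ r)]
    (f : Lp ℂ r (volume.restrict (Ω : Set (Fin n → ℂ)))) (φ : 𝓓(Ω, ℝ)) :
    distributionOfFun Ω f φ = ∫ z in (Ω : Set (Fin n → ℂ)), (φ z : ℂ) * f z := by
  refine (TestFunction.integralAgainstBilinCLM_eq_integral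
    ((locallyIntegrable_Lp Ω r f).locallyIntegrableOn _)).trans ?_
  simp

/-- A form with `L^r` coefficients, `1 ≤ r ≤ ∞`, viewed as a current. -/
def LpForm.toCurrent (Ω : Opens (Fin n → ℂ)) (q : ℕ) (r : ℝ≥0∞) [Fact (1 ≤ r)] :
    LpForm Ω q r →ₗ[ℂ] Current Ω q where
  toFun ω J := distributionOfFun Ω (ω J)
  map_add' ω η := by
    funext J
    ext φ
    have h : ∀ f : Lp ℂ r (volume.restrict (Ω : Set (Fin n → ℂ))),
        Integrable (fun z => (φ z : ℂ) * f z) (volume.restrict (Ω : Set (Fin n → ℂ))) := by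
      intro f
      simpa using TestFunction.integrable_bilin (ContinuousLinearMap.lsmul ℝ ℝ)
        ((locallyIntegrable_Lp Ω r f).locallyIntegrableOn _) φ
    change distributionOfFun Ω (ω J + η J : Lp ℂ r _) φ
      = distributionOfFun Ω (ω J) φ + distributionOfFun Ω (η J) φ
    simp only [distributionOfFun_apply]
    rw [← integral_add (h _) (h _)]
    refine integral_congr_ae ?_
    filter_upwards [Lp.coeFn_add (ω J) (η J)] with z hz
    rw [hz, Pi.add_apply, mul_add]
  map_smul' c ω := by
    funext J
    ext φ
    change distributionOfFun Ω (c • ω J : Lp ℂ r _) φ = c • distributionOfFun Ω (ω J) φ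
    simp only [distributionOfFun_apply]
    rw [smul_eq_mul, ← integral_const_mul]
    refine integral_congr_ae ?_
    filter_upwards [Lp.coeFn_smul c (ω J)] with z hz
    rw [hz, Pi.smul_apply, smul_eq_mul]
    ring

/-- The `(0,q+1)`-forms `ω` with `L^r` coefficients supported in `K` for which `∂̄T = ω` for some
`(0,q)`-current `T` with compact support in `Ω`. -/
def solvableData (Ω : Opens (Fin n → ℂ)) (q : ℕ) (r : ℝ≥0∞) [Fact (1 ≤ r)]
    (K : Set (Fin n → ℂ)) : Submodule ℂ (LpForm Ω (q + 1) r) where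
  carrier := {ω | ω ∈ LpForm.supportedIn Ω (q + 1) r K ∧
    ∃ T : Current Ω q, T.HasCompactSupport ∧ dbar Ω q T = LpForm.toCurrent Ω (q + 1) r ω}
  zero_mem' := ⟨Submodule.zero_mem _, 0,
    ⟨∅, isCompact_empty, Set.empty_subset _, fun _ _ _ => rfl⟩, by rw [map_zero, map_zero]⟩
  add_mem' := by
    rintro ω η ⟨hω, S, ⟨A, hA, hAΩ, hSA⟩, hS⟩ ⟨hη, T, ⟨B, hB, hBΩ, hTB⟩, hT⟩
    refine ⟨Submodule.add_mem _ hω hη, S + T,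
      ⟨A ∪ B, hA.union hB, Set.union_subset hAΩ hBΩ, fun J φ hφ => ?_⟩, by
        rw [map_add, map_add, hS, hT]⟩
    rw [Set.compl_union, Set.subset_inter_iff] at hφ
    change S J φ + T J φ = 0
    rw [hSA J φ hφ.1, hTB J φ hφ.2, add_zero]
  smul_mem' := by
    rintro c ω ⟨hω, S, ⟨A, hA, hAΩ, hSA⟩, hS⟩
    refine ⟨Submodule.smul_mem _ c hω, c • S, ⟨A, hA, hAΩ, fun J φ hφ => ?_⟩, by
      rw [map_smul, map_smul, hS]⟩
    change c • S J φ = 0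
    rw [hSA J φ hφ, smul_zero]

end DbarPolydisc

end

noncomputable section

set_option linter.unusedSectionVars false

namespace DbarPolydisc

open Set Filter Topology Function
open scoped Manifold

/-! If `T` has compact support, integration by parts against an entire function `g` gives `∫ ω g =
0`. In particular every holomorphic moment of the single coefficient `f` of `ω` vanishes. This
necessary condition is shown to be sufficient, by an explicit formula made of one-variable Cauchy
transforms.

Let `f` vanish unless all `|z_i| ≤ ρ`, choose `ρ < s < R < 1`, and let `ψ` be a cutoff of the disc
equal to `1` on `|z| ≤ s` and to `0` for `|z| > R`. With `C_j` the Cauchy transform in the variable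
`z_j`, multiplication by `ψ(z_j)` localises the identity `∂C_j f/∂z̄_j = f` to `f = ∂(A_j f)/∂z̄_j +
B_j f`, where `A_j f = ψ(z_j) C_j f` and `B_j f = -(∂ψ/∂z̄)(z_j) C_j f` (`integral_mul_eq_sub`). Put
`F_0 = f` and `F_{j+1} = B_j F_j`. Telescoping gives `f = ∑_j ∂(A_j F_j)/∂z̄_j + F_n`.

The remainder `F_n` is zero. Indeed `B_j F_j` lives where `|z_j| ≥ s > ρ`; there the Cauchy kernel
is a geometric series in the integration variable, so moments of `F_j` in that variable determine
the result. Hence each step uses up the vanishing of the moments in one more variable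
(`HasVanishingMoments.coordOp_succ`), and after `n` steps `F_n` is orthogonal to every bounded
measurable function. Up to sign, the `A_j F_j` are the coefficients of the solution.

The kernels of `A_j` and `B_j` have uniformly bounded integrals in either variable, so Schur's test
(`eLpNorm_coordOp_le`) bounds both operators on all `L^r`, `1 ≤ r ≤ ∞`, with a constant independent
of `r`. -/

/-! ### The Cauchy–Pompeiu formula for compactly supported functions of one variable. -/

/-- The Wirtinger derivative `∂g/∂z̄` of a real differentiable function. -/
def wirtingerBar (g : ℂ → ℂ) (z : ℂ) : ℂ :=
  (1 / 2 : ℂ) * (fderiv ℝ g z 1 + Complex.I * fderiv ℝ g z Complex.I)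

theorem continuous_wirtingerBar {g : ℂ → ℂ} (hg : ContDiff ℝ 1 g) :
    Continuous (wirtingerBar g) := by
  have h := hg.continuous_fderiv one_ne_zero
  unfold wirtingerBar
  fun_prop

theorem hasCompactSupport_wirtingerBar {g : ℂ → ℂ} (hs : HasCompactSupport g) :
    HasCompactSupport (wirtingerBar g) := by
  refine (hs.fderiv ℝ).mono' (subset_closure.trans' fun z hz => ?_)
  contrapose! hz
  have : fderiv ℝ g z = 0 := by simpa using hz
  simp [wirtingerBar, this]

/-- Continuous functions of polar coordinates vanishing for large radii are integrable. -/
theorem integrableOn_polarTarget {h : ℝ × ℝ → ℂ} (hc : Continuous h) {R : ℝ}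
    (hR : ∀ r θ, R < r → h (r, θ) = 0) :
    IntegrableOn h (Ioi 0 ×ˢ Ioo (-Real.pi) Real.pi) := by
  have h1 : IntegrableOn h (Icc 0 R ×ˢ Icc (-Real.pi) Real.pi) :=
    hc.continuousOn.integrableOn_compact (isCompact_Icc.prod isCompact_Icc)
  refine h1.of_forall_sdiff_eq_zero (measurableSet_Ioi.prod measurableSet_Ioo) ?_
  rintro ⟨r, θ⟩ ⟨⟨h2, h3⟩, h4⟩
  refine hR r θ ?_
  by_contra h5
  exact h4 ⟨⟨le_of_lt h2, not_lt.1 h5⟩, Ioo_subset_Icc_self h3⟩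

theorem hasDerivAt_radial {g : ℂ → ℂ} (hg : ContDiff ℝ 1 g) (e : ℂ) (r : ℝ) :
    HasDerivAt (fun r : ℝ => g (r * e)) (fderiv ℝ g (r * e) e) r := by
  have h1 := (hg.differentiable one_ne_zero (r * e)).hasFDerivAt
  have h2 : HasDerivAt (fun r : ℝ => (r : ℂ) * e) e r := by
    simpa using (Complex.ofRealCLM.hasDerivAt (x := r)).mul_const e
  exact h1.comp_hasDerivAt r h2

theorem hasDerivAt_angular {g : ℂ → ℂ} (hg : ContDiff ℝ 1 g) (r θ : ℝ) :
    HasDerivAt (fun θ : ℝ => g (r * Complex.exp (θ * Complex.I)))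
      (r * fderiv ℝ g (r * Complex.exp (θ * Complex.I))
        (Complex.I * Complex.exp (θ * Complex.I))) θ := by
  have h1 := (hg.differentiable one_ne_zero (r * Complex.exp (θ * Complex.I))).hasFDerivAt
  have h2 : HasDerivAt (fun θ : ℝ => (r : ℂ) * Complex.exp (θ * Complex.I))
      (r • (Complex.I * Complex.exp (θ * Complex.I))) θ := by
    have h3 : HasDerivAt (fun θ : ℝ => (θ : ℂ) * Complex.I) Complex.I θ := by
      simpa using (Complex.ofRealCLM.hasDerivAt (x := θ)).mul_const Complex.I
    have h4 := h3.cexp.const_mul (r : ℂ)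
    rwa [mul_comm (Complex.exp _) Complex.I, ← Complex.real_smul] at h4
  have h5 := h1.comp_hasDerivAt θ h2
  rwa [map_smul, Complex.real_smul] at h5

theorem integral_radial {g : ℂ → ℂ} (hg : ContDiff ℝ 1 g) (hs : HasCompactSupport g) {e : ℂ}
    (he : e ≠ 0) : ∫ r in Ioi (0 : ℝ), fderiv ℝ g (r * e) e = -g 0 := by
  have hs' : HasCompactSupport (fun r : ℝ => g (r * e)) := by
    refine hs.comp_isClosedEmbedding (g := fun r : ℝ => (r : ℂ) * e) ?_
    exact (Homeomorph.mulRight₀ e he).isClosedEmbedding.comp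
      Complex.isometry_ofReal.isClosedEmbedding
  have h1 : ContDiff ℝ 1 (fun r : ℝ => g (r * e)) :=
    hg.comp (Complex.ofRealCLM.contDiff.mul contDiff_const)
  have := hs'.integral_Ioi_deriv_eq h1 0
  simpa [(hasDerivAt_radial hg e _).deriv] using this

theorem integral_angular {g : ℂ → ℂ} (hg : ContDiff ℝ 1 g) {r : ℝ} (hr : 0 < r) :
    ∫ θ in Ioo (-Real.pi) Real.pi, fderiv ℝ g (r * Complex.exp (θ * Complex.I))
      (Complex.I * Complex.exp (θ * Complex.I)) = 0 := by
  have hc := hg.continuous_fderiv one_ne_zero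
  have h1 : ∫ θ in (-Real.pi)..Real.pi, r * fderiv ℝ g (r * Complex.exp (θ * Complex.I))
      (Complex.I * Complex.exp (θ * Complex.I)) = 0 := by
    rw [intervalIntegral.integral_eq_sub_of_hasDerivAt
      (fun θ _ => hasDerivAt_angular hg r θ)]
    · simp [Complex.exp_neg, Complex.exp_pi_mul_I]
    · apply Continuous.intervalIntegrable
      fun_prop
  rw [intervalIntegral.integral_const_mul, intervalIntegral.integral_of_le (by linarith [Real.pi_pos]),
    integral_Ioc_eq_integral_Ioo] at h1
  exact (mul_eq_zero.1 h1).resolve_left (by exact_mod_cast hr.ne')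

/-- In polar coordinates `∂/∂z̄ = (e^{iθ}/2)(∂_r + (i/r) ∂_θ)`. The Jacobian `r` cancels the
singularity of `1/z`, leaving a radial and an angular derivative, each of which can be integrated
exactly. -/
theorem polar_wirtingerBar {r : ℝ} (hr : 0 < r) (θ : ℝ) (L : ℂ →L[ℝ] ℂ) :
    r • ((r * Complex.exp (θ * Complex.I))⁻¹ * ((1 / 2 : ℂ) * (L 1 + Complex.I * L Complex.I))) =
      (1 / 2 : ℂ) * (L (Complex.exp (θ * Complex.I)) +
        Complex.I * L (Complex.I * Complex.exp (θ * Complex.I))) := by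
  have hL : ∀ a b : ℝ, L (a + b * Complex.I) = a * L 1 + b * L Complex.I := by
    intro a b
    have : (a + b * Complex.I : ℂ) = a • (1 : ℂ) + b • Complex.I := by simp
    rw [this, map_add, map_smul, map_smul]; simp
  have h1 : Complex.exp (θ * Complex.I) =
      (Real.cos θ : ℂ) + (Real.sin θ : ℂ) * Complex.I := by
    rw [Complex.exp_mul_I]; simp
  have h2 : Complex.I * Complex.exp (θ * Complex.I) =
      ((-Real.sin θ : ℝ) : ℂ) + (Real.cos θ : ℂ) * Complex.I := by
    rw [h1, Complex.ofReal_neg]; linear_combination (Real.sin θ : ℂ) * Complex.I_sq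
  have h3 : (Complex.exp (θ * Complex.I))⁻¹ =
      (Real.cos θ : ℂ) - (Real.sin θ : ℂ) * Complex.I := by
    rw [← Complex.exp_neg, ← neg_mul, Complex.exp_mul_I]; simp [Complex.cos_neg, sub_eq_add_neg]
  have hr' : (r : ℂ) ≠ 0 := by exact_mod_cast hr.ne'
  rw [h2, mul_inv, h3, h1, hL, hL, Complex.real_smul]
  push_cast
  field_simp
  linear_combination (-Complex.sin θ * L Complex.I) * Complex.I_sq

theorem integral_inv_mul_wirtingerBar_zero {g : ℂ → ℂ} (hg : ContDiff ℝ 1 g)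
    (hs : HasCompactSupport g) : ∫ z, z⁻¹ * wirtingerBar g z = -Real.pi * g 0 := by
  have hc := hg.continuous_fderiv one_ne_zero
  obtain ⟨R, hR⟩ := (hs.fderiv ℝ).isCompact.isBounded.subset_closedBall 0
  have hR' : ∀ r θ : ℝ, max R 0 < r → fderiv ℝ g (r * Complex.exp (θ * Complex.I)) = 0 := by
    intro r θ hr
    have hr0 := (le_max_right R 0).trans_lt hr
    refine image_eq_zero_of_notMem_tsupport fun h => ?_
    have := hR h
    rw [mem_closedBall_zero_iff, norm_mul, Complex.norm_exp_ofReal_mul_I, mul_one,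
      Complex.norm_real, Real.norm_of_nonneg hr0.le] at this
    exact absurd ((le_max_left R 0).trans_lt hr) (not_lt.2 this)
  set h1 : ℝ × ℝ → ℂ := fun p => fderiv ℝ g (p.1 * Complex.exp (p.2 * Complex.I))
    (Complex.exp (p.2 * Complex.I)) with hh1
  set h2 : ℝ × ℝ → ℂ := fun p => fderiv ℝ g (p.1 * Complex.exp (p.2 * Complex.I))
    (Complex.I * Complex.exp (p.2 * Complex.I)) with hh2
  have i1 : IntegrableOn h1 (Ioi 0 ×ˢ Ioo (-Real.pi) Real.pi) :=
    integrableOn_polarTarget (R := max R 0) (by fun_prop) fun r θ hr => by simp [hh1, hR' r θ hr]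
  have i2 : IntegrableOn h2 (Ioi 0 ×ˢ Ioo (-Real.pi) Real.pi) :=
    integrableOn_polarTarget (R := max R 0) (by fun_prop) fun r θ hr => by simp [hh2, hR' r θ hr]
  -- The radial term is integrated in `r` first: each ray contributes `-g 0`, and the rays fill an
  -- angle `2π`. The angular term below vanishes by periodicity on each circle.
  have e1 : ∫ p in Ioi 0 ×ˢ Ioo (-Real.pi) Real.pi, h1 p = -(2 * Real.pi) * g 0 := by
    rw [Measure.volume_eq_prod, ← setIntegral_prod_swap,
      setIntegral_prod _ (by exact i1.swap)]
    have : ∀ θ : ℝ, ∫ r in Ioi (0 : ℝ), h1 (θ, r).swap = -g 0 := fun θ =>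
      integral_radial hg hs (Complex.exp_ne_zero (θ * Complex.I))
    simp only [this, setIntegral_const, Real.volume_real_Ioo_of_le (neg_le_self Real.pi_pos.le),
      Complex.real_smul]
    push_cast; ring
  have e2 : ∫ p in Ioi 0 ×ˢ Ioo (-Real.pi) Real.pi, h2 p = 0 := by
    rw [Measure.volume_eq_prod, setIntegral_prod _ i2]
    rw [setIntegral_congr_fun (g := fun _ => 0) measurableSet_Ioi]
    · simp
    · intro r hr
      exact integral_angular hg hr
  rw [← Complex.integral_comp_polarCoord_symm, polarCoord_target]
  rw [setIntegral_congr_fun (g := fun p => (1 / 2 : ℂ) * (h1 p + Complex.I * h2 p))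
    (measurableSet_Ioi.prod measurableSet_Ioo)]
  · rw [integral_const_mul, integral_add i1 (i2.const_mul _), integral_const_mul, e1, e2]
    ring
  · rintro ⟨r, θ⟩ ⟨hr, -⟩
    have : Complex.polarCoord.symm (r, θ) = r * Complex.exp (θ * Complex.I) := by
      rw [Complex.polarCoord_symm_apply, Complex.exp_mul_I]; simp
    simp only [this, hh1, hh2, wirtingerBar]
    exact polar_wirtingerBar hr θ _

theorem integral_inv_sub_mul_wirtingerBar {g : ℂ → ℂ} (hg : ContDiff ℝ 1 g)
    (hs : HasCompactSupport g) (w : ℂ) :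
    ∫ z, (z - w)⁻¹ * wirtingerBar g z = -Real.pi * g w := by
  have hg' : ContDiff ℝ 1 (fun z => g (z + w)) := hg.comp (contDiff_id.add contDiff_const)
  have hs' : HasCompactSupport (fun z => g (z + w)) :=
    hs.comp_homeomorph (Homeomorph.addRight w)
  have h := integral_inv_mul_wirtingerBar_zero hg' hs'
  rw [← integral_add_right_eq_self _ w]
  simpa [wirtingerBar, fderiv_comp_add_right] using h

/-! ### Integrability of the Cauchy kernel. -/

theorem lintegral_inv_ball_lt_top : ∫⁻ z in Metric.ball (0 : ℂ) 1, ‖z⁻¹‖ₑ < ∞ := by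
  rw [← lintegral_indicator Metric.isOpen_ball.measurableSet,
    ← Complex.lintegral_comp_polarCoord_symm, polarCoord_target]
  have h : ∀ p ∈ Ioi (0 : ℝ) ×ˢ Ioo (-Real.pi) Real.pi,
      ENNReal.ofReal p.1 • (Metric.ball (0 : ℂ) 1).indicator (fun z => ‖z⁻¹‖ₑ)
        (Complex.polarCoord.symm p) ≤
      (Ioo (0 : ℝ) 1 ×ˢ Ioo (-Real.pi) Real.pi).indicator 1 p := by
    rintro p ⟨hr, hθ⟩
    have hp : ‖Complex.polarCoord.symm p‖ = p.1 := by
      rw [Complex.norm_polarCoord_symm, abs_of_pos hr]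
    by_cases h1 : p.1 < 1
    · rw [indicator_of_mem (by rwa [mem_ball_zero_iff, hp]), indicator_of_mem (by exact ⟨⟨hr, h1⟩, hθ⟩),
        ← ofReal_norm, norm_inv, hp, smul_eq_mul, ← ENNReal.ofReal_mul (le_of_lt hr),
        mul_inv_cancel₀ (ne_of_gt hr)]
      simp
    · rw [indicator_of_notMem (by rwa [mem_ball_zero_iff, hp])]
      simp
  refine (setLIntegral_mono' (measurableSet_Ioi.prod measurableSet_Ioo) h).trans_lt ?_
  refine (setLIntegral_le_lintegral _ _).trans_lt ?_
  rw [lintegral_indicator_one (measurableSet_Ioo.prod measurableSet_Ioo)]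
  exact (Metric.isBounded_Ioo _ _).prod (Metric.isBounded_Ioo _ _) |>.measure_lt_top

/-- The Cauchy kernel is integrable over the unit disc, uniformly in the pole. -/
theorem exists_lintegral_inv_sub_le : ∃ M : NNReal, ∀ w : ℂ,
    ∫⁻ z in Metric.ball (0 : ℂ) 1, ‖(z - w)⁻¹‖ₑ ≤ M := by
  have hfin : (∫⁻ z in Metric.ball (0 : ℂ) 1, ‖z⁻¹‖ₑ) + volume (Metric.ball (0 : ℂ) 1) ≠ ∞ :=
    ENNReal.add_ne_top.2 ⟨lintegral_inv_ball_lt_top.ne, measure_ball_lt_top.ne⟩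
  refine ⟨((∫⁻ z in Metric.ball (0 : ℂ) 1, ‖z⁻¹‖ₑ) +
    volume (Metric.ball (0 : ℂ) 1)).toNNReal, fun w => ?_⟩
  · rw [ENNReal.coe_toNNReal hfin]
    -- Within distance `1` of the pole the kernel is a translate of `1/z` on the unit disc;
    -- elsewhere it is at most `1`. Both bounds are independent of `w`.
    have h : ∀ z, ‖(z - w)⁻¹‖ₑ ≤
        (Metric.ball (0 : ℂ) 1).indicator (fun z => ‖z⁻¹‖ₑ) (z - w) + 1 := by
      intro z
      by_cases h1 : z - w ∈ Metric.ball (0 : ℂ) 1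
      · rw [indicator_of_mem h1]; exact le_self_add
      · rw [indicator_of_notMem h1, zero_add, ← ofReal_norm, ENNReal.ofReal_le_one,
          norm_inv]
        exact inv_le_one_of_one_le₀ (by simpa using h1)
    calc _ ≤ ∫⁻ z in Metric.ball (0 : ℂ) 1,
          ((Metric.ball (0 : ℂ) 1).indicator (fun z => ‖z⁻¹‖ₑ) (z - w) + 1) :=
          lintegral_mono h
      _ = (∫⁻ z in Metric.ball (0 : ℂ) 1,
          (Metric.ball (0 : ℂ) 1).indicator (fun z => ‖z⁻¹‖ₑ) (z - w)) +
            volume (Metric.ball (0 : ℂ) 1) := by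
          rw [lintegral_add_right _ measurable_const]; simp
      _ ≤ _ := by
          refine add_le_add ?_ le_rfl
          refine (setLIntegral_le_lintegral _ _).trans ?_
          rw [lintegral_sub_right_eq_self
            (fun z => (Metric.ball (0 : ℂ) 1).indicator (fun z => ‖z⁻¹‖ₑ) z) w,
            lintegral_indicator Metric.isOpen_ball.measurableSet]

/-! ### Integral operators in one coordinate and Schur's test. -/

section CoordinateOperators

variable {ι X : Type*} [Fintype ι] [DecidableEq ι] [MeasurableSpace X]

/-- The involution of `Xᶥ × X` exchanging the coordinate `j` of the point of `Xᶥ` with the point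
of `X`. -/
def swapAt (j : ι) : ((ι → X) × X) ≃ᵐ ((ι → X) × X) where
  toFun p := (update p.1 j p.2, p.1 j)
  invFun p := (update p.1 j p.2, p.1 j)
  left_inv p := by simp
  right_inv p := by simp
  measurable_toFun := measurable_update'.prodMk ((measurable_pi_apply j).comp measurable_fst)
  measurable_invFun := measurable_update'.prodMk ((measurable_pi_apply j).comp measurable_fst)

@[simp] theorem swapAt_apply (j : ι) (p : (ι → X) × X) :
    swapAt j p = (update p.1 j p.2, p.1 j) := rfl

/-- Exchanging `z_j` with the integration variable turns an operator in the coordinate `j` into its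
transpose, so this invariance drives both duality and Schur's test. It is enough to check it on
boxes, where two factors of a product trade places. -/
theorem measurePreserving_swapAt (ν : Measure X) [SigmaFinite ν] (j : ι) :
    MeasurePreserving (swapAt j) ((Measure.pi fun _ : ι => ν).prod ν)
      ((Measure.pi fun _ : ι => ν).prod ν) := by
  refine ⟨(swapAt j).measurable, Eq.symm ?_⟩
  refine Measure.prod_eq_generateFrom generateFrom_pi MeasurableSpace.generateFrom_measurableSet
    isPiSystem_pi MeasurableSpace.isPiSystem_measurableSet
    (Measure.FiniteSpanningSetsIn.pi fun _ => ν.toFiniteSpanningSetsIn)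
    ν.toFiniteSpanningSetsIn ?_
  rintro _ ⟨s, hs, rfl⟩ t ht
  rw [mem_univ_pi] at hs
  have hset : swapAt j ⁻¹' (univ.pi s ×ˢ t) = univ.pi (update s j t) ×ˢ s j := by
    ext p
    simp only [mem_preimage, swapAt_apply, mem_prod, mem_univ_pi]
    constructor
    · rintro ⟨h1, h2⟩
      refine ⟨fun i => ?_, by simpa using h1 j⟩
      rcases eq_or_ne i j with rfl | hi
      · simpa using h2
      · simpa [hi] using h1 i
    · rintro ⟨h1, h2⟩
      refine ⟨fun i => ?_, by simpa using h1 j⟩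
      rcases eq_or_ne i j with rfl | hi
      · simpa using h2
      · simpa [hi] using h1 i
  rw [MeasurableEquiv.map_apply, hset, Measure.prod_prod, Measure.pi_pi, Measure.pi_pi]
  rw [← Finset.mul_prod_erase _ _ (Finset.mem_univ j),
    ← Finset.mul_prod_erase _ (fun i => ν (s i)) (Finset.mem_univ j), update_self]
  rw [Finset.prod_congr rfl (g := fun i => ν (s i))
    fun i hi => by rw [update_of_ne (Finset.ne_of_mem_erase hi)]]
  ring

/-- Integral kernels to which Schur's test applies, with the constant `C`. -/
structure IsSchurKernel (ν : Measure X) (k : X → X → ℂ) (C : NNReal) : Prop where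
  measurable : Measurable (uncurry k)
  lintegral_left : ∀ y, ∫⁻ x, ‖k x y‖ₑ ∂ν ≤ C
  lintegral_right : ∀ x, ∫⁻ y, ‖k x y‖ₑ ∂ν ≤ C

/-- The integral operator with kernel `k`, acting in the coordinate `j`. -/
def coordOp (ν : Measure X) (k : X → X → ℂ) (j : ι) (f : (ι → X) → ℂ) (z : ι → X) : ℂ :=
  ∫ w, k (z j) w * f (update z j w) ∂ν

variable {ν : Measure X} [IsFiniteMeasure ν] {k : X → X → ℂ} {C : NNReal}
  {μ : Measure (ι → X)} (hμ : μ = Measure.pi fun _ => ν) (hk : IsSchurKernel ν k C) (j : ι)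

-- Needed for `coordOp` to be well defined on almost everywhere classes: a null set of points
-- remains null on almost every slice in the direction `j`.
include hμ in
theorem ae_update_of_ae {p : (ι → X) → Prop} (h : ∀ᵐ z ∂μ, p z) :
    ∀ᵐ z ∂μ, ∀ᵐ w ∂ν, p (update z j w) := by
  subst hμ
  have h1 : ∀ᵐ q ∂((Measure.pi fun _ : ι => ν).prod ν), p q.1 :=
    Measure.quasiMeasurePreserving_fst.ae h
  exact Measure.ae_ae_of_ae_prod ((measurePreserving_swapAt ν j).quasiMeasurePreserving.ae h1)

include hμ in
theorem coordOp_congr_ae {f g : (ι → X) → ℂ} (h : f =ᵐ[μ] g) :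
    coordOp ν k j f =ᵐ[μ] coordOp ν k j g := by
  filter_upwards [ae_update_of_ae hμ j h] with z hz
  exact integral_congr_ae (hz.mono fun w hw => by simp only [hw])

-- After the exchange of variables `f` no longer depends on `w`, so the inner integral is at most `C
-- |f|`. Integrability of the actual integrand of `coordOp` follows by swapping back.
include hμ hk in
theorem integrable_transposed {f : (ι → X) → ℂ} (hf : Integrable f μ) :
    Integrable (fun p : (ι → X) × X => k p.2 (p.1 j) * f p.1) (μ.prod ν) := by
  subst hμ
  have hm : Measurable fun p : (ι → X) × X => k p.2 (p.1 j) :=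
    hk.measurable.comp (measurable_snd.prodMk ((measurable_pi_apply j).comp measurable_fst))
  have hm2 : AEStronglyMeasurable (fun p : (ι → X) × X => k p.2 (p.1 j) * f p.1)
      ((Measure.pi fun _ : ι => ν).prod ν) :=
    hm.aestronglyMeasurable.mul hf.aestronglyMeasurable.comp_fst
  refine ⟨hm2, ?_⟩
  rw [HasFiniteIntegral, lintegral_prod _ hm2.enorm]
  simp only [enorm_mul]
  have : ∀ z : ι → X, ∫⁻ w, ‖k w (z j)‖ₑ * ‖f z‖ₑ ∂ν ≤ C * ‖f z‖ₑ := fun z => by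
    rw [lintegral_mul_const' _ _ enorm_ne_top]
    gcongr
    exact hk.lintegral_left _
  refine (lintegral_mono this).trans_lt ?_
  rw [lintegral_const_mul' _ _ ENNReal.coe_ne_top]
  exact ENNReal.mul_lt_top ENNReal.coe_lt_top hf.hasFiniteIntegral

include hμ hk in
theorem integrable_coordOp_integrand {f : (ι → X) → ℂ} (hf : Integrable f μ) :
    Integrable (fun p : (ι → X) × X => k (p.1 j) p.2 * f (update p.1 j p.2)) (μ.prod ν) := by
  have := integrable_transposed hμ hk j hf
  subst hμ
  simpa [comp_def] using (measurePreserving_swapAt ν j).integrable_comp_of_integrable this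

include hμ hk in
theorem integrable_coordOp {f : (ι → X) → ℂ} (hf : Integrable f μ) :
    Integrable (coordOp ν k j f) μ := by
  have : IsFiniteMeasure μ := by rw [hμ]; infer_instance
  exact (integrable_coordOp_integrand hμ hk j hf).integral_prod_left

include hk in
theorem measurable_coordOp {f : (ι → X) → ℂ} (hf : Measurable f) :
    Measurable (coordOp ν k j f) := by
  have hj : Measurable fun p : (ι → X) × X => p.1 j := (measurable_pi_apply j).comp measurable_fst
  have hm1 : Measurable fun p : (ι → X) × X => k (p.1 j) p.2 :=
    hk.measurable.comp (hj.prodMk measurable_snd)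
  have hm2 : Measurable fun p : (ι → X) × X => f (update p.1 j p.2) :=
    hf.comp measurable_update'
  exact (hm1.mul hm2).stronglyMeasurable.integral_prod_right.measurable

include hk in
theorem norm_coordOp_le {f : (ι → X) → ℂ} {M : NNReal} {z : ι → X}
    (hf : ∀ᵐ w ∂ν, ‖f (update z j w)‖ₑ ≤ M) : ‖coordOp ν k j f z‖ₑ ≤ C * M := by
  calc ‖coordOp ν k j f z‖ₑ ≤ ∫⁻ w, ‖k (z j) w * f (update z j w)‖ₑ ∂ν :=
        enorm_integral_le_lintegral_enorm _
    _ ≤ ∫⁻ w, ‖k (z j) w‖ₑ * M ∂ν := lintegral_mono_ae (hf.mono fun w hw => by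
        rw [enorm_mul]; gcongr)
    _ ≤ C * M := by
        rw [lintegral_mul_const' _ _ ENNReal.coe_ne_top]
        gcongr
        exact hk.lintegral_right _

include hμ hk in
/-- The operator acting in one coordinate and its transpose. -/
theorem integral_coordOp_mul {f φ : (ι → X) → ℂ} (hf : Integrable f μ) (hφ : Measurable φ)
    {M : ℝ} (hM : ∀ z, ‖φ z‖ ≤ M) :
    ∫ z, coordOp ν k j f z * φ z ∂μ = ∫ z, f z * coordOp ν (fun x y => k y x) j φ z ∂μ := by
  have h1 := integrable_coordOp_integrand hμ hk j hf
  have h2 := integrable_transposed hμ hk j hf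
  subst hμ
  have h1' : Integrable (fun p : (ι → X) × X =>
      k (p.1 j) p.2 * f (update p.1 j p.2) * φ p.1) ((Measure.pi fun _ : ι => ν).prod ν) :=
    h1.mul_bdd (c := M) (hφ.comp measurable_fst).aestronglyMeasurable
      (.of_forall fun p => hM p.1)
  have h2' : Integrable (fun p : (ι → X) × X =>
      k p.2 (p.1 j) * f p.1 * φ (update p.1 j p.2)) ((Measure.pi fun _ : ι => ν).prod ν) :=
    h2.mul_bdd (c := M) (hφ.comp measurable_update').aestronglyMeasurable
      (.of_forall fun p => hM _)
  calc _ = ∫ z, ∫ w, k (z j) w * f (update z j w) * φ z ∂ν ∂(Measure.pi fun _ : ι => ν) := by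
        simp only [coordOp, integral_mul_const]
    _ = ∫ p, k (p.1 j) p.2 * f (update p.1 j p.2) * φ p.1 ∂((Measure.pi fun _ : ι => ν).prod ν) :=
        (integral_prod _ h1').symm
    _ = ∫ p, k p.2 (p.1 j) * f p.1 * φ (update p.1 j p.2)
          ∂((Measure.pi fun _ : ι => ν).prod ν) := by
        rw [← (measurePreserving_swapAt ν j).integral_comp']
        simp
    _ = _ := by
        rw [integral_prod _ h2']
        refine integral_congr_ae (.of_forall fun z => ?_)
        simp only [coordOp]
        rw [← integral_const_mul]
        congr 1; ext w; ring

-- Hölder's inequality applied to `|k| |f| = |k|^{1-1/p} (|k| |f|^p)^{1/p}`. In this form `p = 1`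
-- needs no separate treatment.
include hk in
theorem enorm_coordOp_rpow_le {f : (ι → X) → ℂ} (hf : Measurable f) {p : ℝ} (hp : 1 ≤ p)
    (z : ι → X) : ‖coordOp ν k j f z‖ₑ ^ p ≤
      (C : ℝ≥0∞) ^ (p - 1) * ∫⁻ w, ‖k (z j) w‖ₑ * ‖f (update z j w)‖ₑ ^ p ∂ν := by
  have hp0 : 0 < p := one_pos.trans_le hp
  have hm1 : Measurable fun w => ‖k (z j) w‖ₑ :=
    (hk.measurable.comp (measurable_const.prodMk measurable_id)).enorm
  have hm2 : Measurable fun w => ‖k (z j) w‖ₑ * ‖f (update z j w)‖ₑ ^ p :=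
    hm1.mul ((hf.comp (measurable_update z)).enorm.pow_const _)
  have h1 : ‖coordOp ν k j f z‖ₑ ≤ (C : ℝ≥0∞) ^ (1 - 1 / p) *
      (∫⁻ w, ‖k (z j) w‖ₑ * ‖f (update z j w)‖ₑ ^ p ∂ν) ^ (1 / p) := by
    calc ‖coordOp ν k j f z‖ₑ ≤ ∫⁻ w, ‖k (z j) w * f (update z j w)‖ₑ ∂ν :=
          enorm_integral_le_lintegral_enorm _
      _ = ∫⁻ w, ‖k (z j) w‖ₑ ^ (1 - 1 / p) *
            (‖k (z j) w‖ₑ * ‖f (update z j w)‖ₑ ^ p) ^ (1 / p) ∂ν := by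
          congr 1; ext w
          rw [enorm_mul, ENNReal.mul_rpow_of_nonneg _ _ (by positivity), ← mul_assoc,
            ← ENNReal.rpow_add_of_nonneg _ _ (by rw [sub_nonneg, div_le_one hp0]; exact hp)
              (by positivity), ← ENNReal.rpow_mul, mul_one_div_cancel hp0.ne']
          simp
      _ ≤ (∫⁻ w, ‖k (z j) w‖ₑ ∂ν) ^ (1 - 1 / p) *
            (∫⁻ w, ‖k (z j) w‖ₑ * ‖f (update z j w)‖ₑ ^ p ∂ν) ^ (1 / p) :=
          ENNReal.lintegral_mul_norm_pow_le hm1.aemeasurable hm2.aemeasurable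
            (by rw [sub_nonneg, div_le_one hp0]; exact hp) (by positivity) (by ring)
      _ ≤ _ := by
          gcongr
          · rw [sub_nonneg, div_le_one hp0]; exact hp
          · exact hk.lintegral_right _
  calc _ ≤ ((C : ℝ≥0∞) ^ (1 - 1 / p) *
      (∫⁻ w, ‖k (z j) w‖ₑ * ‖f (update z j w)‖ₑ ^ p ∂ν) ^ (1 / p)) ^ p := by gcongr
    _ = _ := by
      rw [ENNReal.mul_rpow_of_nonneg _ _ hp0.le, ← ENNReal.rpow_mul, ← ENNReal.rpow_mul,
        one_div_mul_cancel hp0.ne', ENNReal.rpow_one, sub_mul, one_div_mul_cancel hp0.ne', one_mul]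

include hμ hk in
theorem lintegral_coordOp_rpow_le {f : (ι → X) → ℂ} (hf : Measurable f) {p : ℝ} (hp : 1 ≤ p) :
    ∫⁻ z, ‖coordOp ν k j f z‖ₑ ^ p ∂μ ≤ (C : ℝ≥0∞) ^ p * ∫⁻ z, ‖f z‖ₑ ^ p ∂μ := by
  subst hμ
  have hj : Measurable fun q : (ι → X) × X => q.1 j := (measurable_pi_apply j).comp measurable_fst
  have hk1 : Measurable fun q : (ι → X) × X => k (q.1 j) q.2 :=
    hk.measurable.comp (hj.prodMk measurable_snd)
  have hk2 : Measurable fun q : (ι → X) × X => k q.2 (q.1 j) :=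
    hk.measurable.comp (measurable_snd.prodMk hj)
  have hf1 : Measurable fun q : (ι → X) × X => f (update q.1 j q.2) := hf.comp measurable_update'
  have hm1 : Measurable fun q : (ι → X) × X => ‖k (q.1 j) q.2‖ₑ * ‖f (update q.1 j q.2)‖ₑ ^ p :=
    hk1.enorm.mul (hf1.enorm.pow_const _)
  have hm2 : Measurable fun q : (ι → X) × X => ‖k q.2 (q.1 j)‖ₑ * ‖f q.1‖ₑ ^ p :=
    hk2.enorm.mul ((hf.comp measurable_fst).enorm.pow_const _)
  calc _ ≤ ∫⁻ z, (C : ℝ≥0∞) ^ (p - 1) * ∫⁻ w, ‖k (z j) w‖ₑ * ‖f (update z j w)‖ₑ ^ p ∂ν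
          ∂(Measure.pi fun _ : ι => ν) := lintegral_mono fun z => enorm_coordOp_rpow_le hk j hf hp z
    _ = (C : ℝ≥0∞) ^ (p - 1) * ∫⁻ q, ‖k (q.1 j) q.2‖ₑ * ‖f (update q.1 j q.2)‖ₑ ^ p
          ∂((Measure.pi fun _ : ι => ν).prod ν) := by
        rw [lintegral_const_mul' _ _ (ENNReal.rpow_ne_top_of_nonneg (by linarith)
          ENNReal.coe_ne_top), lintegral_prod _ hm1.aemeasurable]
    -- After the swap the integral in `w` falls on the first argument of the kernel, and the other
    -- Schur bound supplies the last factor `C`.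
    _ = (C : ℝ≥0∞) ^ (p - 1) * ∫⁻ q, ‖k q.2 (q.1 j)‖ₑ * ‖f q.1‖ₑ ^ p
          ∂((Measure.pi fun _ : ι => ν).prod ν) := by
        rw [← (measurePreserving_swapAt ν j).lintegral_comp hm2]
        simp
    _ ≤ (C : ℝ≥0∞) ^ (p - 1) * ∫⁻ z, C * ‖f z‖ₑ ^ p ∂(Measure.pi fun _ : ι => ν) := by
        rw [lintegral_prod _ hm2.aemeasurable]
        gcongr with z
        have : Measurable fun w => ‖k w (z j)‖ₑ :=
          (hk.measurable.comp (measurable_id.prodMk measurable_const)).enorm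
        simp only
        rw [lintegral_mul_const _ this]
        gcongr
        exact hk.lintegral_left _
    _ = _ := by
        rw [lintegral_const_mul' _ _ ENNReal.coe_ne_top, ← mul_assoc]
        congr 1
        conv_lhs => rw [← ENNReal.rpow_one (C : ℝ≥0∞), ← ENNReal.rpow_mul, mul_comm, one_mul]
        rw [← ENNReal.rpow_add_of_nonneg _ _ zero_le_one (by linarith)]
        simp

include hμ hk in
/-- Schur's test in one coordinate. -/
theorem eLpNorm_coordOp_le {f : (ι → X) → ℂ} {r : ℝ≥0∞} (hr : 1 ≤ r) (hf : MemLp f r μ) :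
    eLpNorm (coordOp ν k j f) r μ ≤ C * eLpNorm f r μ := by
  rcases eq_or_ne r ∞ with rfl | hr'
  · simp only [eLpNorm_exponent_top]
    have hM : eLpNormEssSup f μ ≠ ∞ := by simpa using hf.eLpNorm_ne_top
    lift eLpNormEssSup f μ to NNReal using hM with M hM'
    refine eLpNormEssSup_le_of_ae_enorm_bound ?_
    filter_upwards [ae_update_of_ae hμ j (ae_le_eLpNormEssSup (f := f) (μ := μ))] with z hz
    rw [← hM'] at hz
    exact norm_coordOp_le hk j hz
  · set g := hf.aestronglyMeasurable.mk f with hg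
    have hfg : f =ᵐ[μ] g := hf.aestronglyMeasurable.ae_eq_mk
    have hgm : Measurable g := hf.aestronglyMeasurable.stronglyMeasurable_mk.measurable
    rw [eLpNorm_congr_ae (coordOp_congr_ae hμ j hfg), eLpNorm_congr_ae hfg]
    have hr0 : r ≠ 0 := (one_pos.trans_le hr).ne'
    have hp : 1 ≤ r.toReal := by
      rw [← ENNReal.toReal_one]; exact ENNReal.toReal_mono hr' hr
    have hp0 : 0 < r.toReal := one_pos.trans_le hp
    rw [eLpNorm_eq_lintegral_rpow_enorm_toReal hr0 hr', eLpNorm_eq_lintegral_rpow_enorm_toReal hr0 hr']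
    calc _ ≤ ((C : ℝ≥0∞) ^ r.toReal * ∫⁻ z, ‖g z‖ₑ ^ r.toReal ∂μ) ^ (1 / r.toReal) := by
          gcongr
          exact lintegral_coordOp_rpow_le hμ hk j hgm hp
      _ = _ := by
          rw [ENNReal.mul_rpow_of_nonneg _ _ (by positivity), ← ENNReal.rpow_mul,
            mul_one_div_cancel hp0.ne', ENNReal.rpow_one]

include hμ in
theorem integrable_of_memLp {f : (ι → X) → ℂ} {r : ℝ≥0∞} (hr : 1 ≤ r) (hf : MemLp f r μ) :
    Integrable f μ := by
  have : IsFiniteMeasure μ := by rw [hμ]; infer_instance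
  exact hf.integrable hr

include hμ hk in
theorem memLp_coordOp {f : (ι → X) → ℂ} {r : ℝ≥0∞} (hr : 1 ≤ r) (hf : MemLp f r μ) :
    MemLp (coordOp ν k j f) r μ :=
  ⟨(integrable_coordOp hμ hk j (integrable_of_memLp hμ hr hf)).aestronglyMeasurable,
    (eLpNorm_coordOp_le hμ hk j hr hf).trans_lt
      (ENNReal.mul_lt_top ENNReal.coe_lt_top hf.eLpNorm_lt_top)⟩

include hμ hk in
theorem coordOp_add_ae {f g : (ι → X) → ℂ} (hf : Integrable f μ) (hg : Integrable g μ) :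
    coordOp ν k j (f + g) =ᵐ[μ] coordOp ν k j f + coordOp ν k j g := by
  have : IsFiniteMeasure μ := by rw [hμ]; infer_instance
  filter_upwards [(integrable_coordOp_integrand hμ hk j hf).prod_right_ae,
    (integrable_coordOp_integrand hμ hk j hg).prod_right_ae] with z h1 h2
  simp only [coordOp, Pi.add_apply, mul_add]
  exact integral_add h1 h2

theorem coordOp_smul (c : ℂ) (f : (ι → X) → ℂ) :
    coordOp ν k j (c • f) = c • coordOp ν k j f := by
  ext z
  simp only [coordOp, Pi.smul_apply, smul_eq_mul]
  rw [← integral_const_mul]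
  congr 1; ext w; ring

/-- The operator acting in one coordinate, as a bounded operator on `L^r`. -/
def coordOpLp (r : ℝ≥0∞) [hr : Fact (1 ≤ r)] : Lp ℂ r μ →L[ℂ] Lp ℂ r μ :=
  LinearMap.mkContinuous
    { toFun := fun f => (memLp_coordOp hμ hk j hr.out (Lp.memLp f)).toLp _
      map_add' := fun f g => by
        rw [← MemLp.toLp_add, MemLp.toLp_eq_toLp_iff]
        exact (coordOp_congr_ae hμ j (Lp.coeFn_add f g)).trans
          (coordOp_add_ae hμ hk j (integrable_of_memLp hμ hr.out (Lp.memLp f))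
            (integrable_of_memLp hμ hr.out (Lp.memLp g)))
      map_smul' := fun c f => by
        rw [RingHom.id_apply, ← MemLp.toLp_const_smul, MemLp.toLp_eq_toLp_iff, ← coordOp_smul]
        exact coordOp_congr_ae hμ j (Lp.coeFn_smul c f) } C fun f => by
    change ‖(memLp_coordOp hμ hk j hr.out (Lp.memLp f)).toLp _‖ ≤ _
    rw [Lp.norm_toLp, Lp.norm_def, ← ENNReal.coe_toReal C, ← ENNReal.toReal_mul]
    exact ENNReal.toReal_mono (ENNReal.mul_ne_top ENNReal.coe_ne_top (Lp.memLp f).eLpNorm_ne_top)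
      (eLpNorm_coordOp_le hμ hk j hr.out (Lp.memLp f))

theorem coordOpLp_coeFn (r : ℝ≥0∞) [hr : Fact (1 ≤ r)] (f : Lp ℂ r μ) :
    coordOpLp hμ hk j r f =ᵐ[μ] coordOp ν k j f :=
  MemLp.coeFn_toLp (memLp_coordOp hμ hk j hr.out (Lp.memLp f))

theorem norm_coordOpLp_le (r : ℝ≥0∞) [hr : Fact (1 ≤ r)] (f : Lp ℂ r μ) :
    ‖coordOpLp hμ hk j r f‖ ≤ C * ‖f‖ :=
  ((coordOpLp hμ hk j r).le_opNorm f).trans <| by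
    gcongr
    exact LinearMap.mkContinuous_norm_le _ C.coe_nonneg _

include hμ in
/-- The operator acting in the coordinate `j` preserves vanishing off a set described by another
coordinate. -/
theorem coordOp_ae_eq_zero_of_ne {f : (ι → X) → ℂ} {i : ι} (hij : i ≠ j) {s : Set X}
    (hf : ∀ᵐ z ∂μ, z i ∉ s → f z = 0) : ∀ᵐ z ∂μ, z i ∉ s → coordOp ν k j f z = 0 := by
  filter_upwards [ae_update_of_ae hμ j hf] with z hz hzi
  rw [coordOp, integral_congr_ae (g := fun _ => 0), integral_zero]
  filter_upwards [hz] with w hw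
  rw [hw (by rwa [update_of_ne hij]), mul_zero]

end CoordinateOperators

/-! ### The polydisc as a product, truncated Cauchy kernels and cutoff functions. -/

/-- Lebesgue measure on the unit disc. -/
abbrev discMeasure : Measure ℂ := volume.restrict (Metric.ball 0 1)

/-- Lebesgue measure on the unit polydisc. -/
abbrev polydiscMeasure (n : ℕ) : Measure (Fin n → ℂ) :=
  volume.restrict (polydisc n : Set (Fin n → ℂ))

theorem polydisc_eq_pi (n : ℕ) :
    (polydisc n : Set (Fin n → ℂ)) = univ.pi fun _ => Metric.ball (0 : ℂ) 1 := by
  ext z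
  simp [polydisc]

theorem polydiscMeasure_eq_pi (n : ℕ) :
    polydiscMeasure n = Measure.pi fun _ => discMeasure := by
  rw [polydiscMeasure, polydisc_eq_pi, volume_pi, Measure.restrict_pi_pi]

instance : IsFiniteMeasure discMeasure := ⟨by simp⟩

instance (n : ℕ) : IsFiniteMeasure (polydiscMeasure n) := by
  rw [polydiscMeasure_eq_pi]; infer_instance

/-- The Cauchy kernel multiplied by a function of the first variable. -/
def cauchyKernel (ψ : ℂ → ℂ) (z w : ℂ) : ℂ := (Real.pi : ℂ)⁻¹ * ψ z * (z - w)⁻¹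

theorem exists_isSchurKernel_cauchyKernel {ψ : ℂ → ℂ} (hc : Continuous ψ)
    (hs : HasCompactSupport ψ) : ∃ C, IsSchurKernel discMeasure (cauchyKernel ψ) C := by
  obtain ⟨M, hM⟩ := exists_lintegral_inv_sub_le
  obtain ⟨B, hB⟩ := hc.bounded_above_of_compact_support hs
  have hB0 : 0 ≤ B := (norm_nonneg _).trans (hB 0)
  have hle : ∀ z w, ‖cauchyKernel ψ z w‖ₑ ≤ ‖(Real.pi : ℂ)⁻¹‖ₑ * B.toNNReal * ‖(z - w)⁻¹‖ₑ := by
    intro z w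
    rw [cauchyKernel, enorm_mul, enorm_mul]
    gcongr
    rw [← ofReal_norm]
    exact ENNReal.ofReal_le_ofReal (hB z)
  refine ⟨‖(Real.pi : ℂ)⁻¹‖₊ * B.toNNReal * M, ?_, fun w => ?_, fun z => ?_⟩
  · have h1 : Measurable fun p : ℂ × ℂ => (Real.pi : ℂ)⁻¹ * ψ p.1 * (p.1 - p.2)⁻¹ :=
      ((hc.measurable.comp measurable_fst).const_mul _).mul
        (measurable_fst.sub measurable_snd).inv
    exact h1
  · refine (lintegral_mono fun z => hle z w).trans ?_
    rw [lintegral_const_mul' _ _ (ENNReal.mul_ne_top enorm_ne_top ENNReal.coe_ne_top)]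
    push_cast
    gcongr
    · exact le_rfl
    · exact hM w
  · refine (lintegral_mono fun w => hle z w).trans ?_
    rw [lintegral_const_mul' _ _ (ENNReal.mul_ne_top enorm_ne_top ENNReal.coe_ne_top)]
    push_cast
    gcongr
    · exact le_rfl
    -- The modulus of `(z - w)⁻¹` is symmetric, so the bound uniform in the pole also serves for the
    -- other variable.
    · refine le_trans (lintegral_mono fun w => ?_) (hM z)
      rw [← enorm_neg, ← inv_neg, neg_sub]

theorem IsSchurKernel.integrable_left {X : Type*} [MeasurableSpace X] {ν : Measure X}
    {k : X → X → ℂ} {C : NNReal} (hk : IsSchurKernel ν k C) (y : X) :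
    Integrable (fun x => k x y) ν :=
  ⟨(hk.measurable.comp (measurable_id.prodMk measurable_const)).aestronglyMeasurable,
    (hk.lintegral_left y).trans_lt ENNReal.coe_lt_top⟩

/-- A cutoff function of the disc: `1` on the disc of radius `s` and supported in the disc of
radius `R`. -/
structure IsCutoff (ψ : ℂ → ℂ) (s R : ℝ) : Prop where
  contDiff : ContDiff ℝ 1 ψ
  eq_one : ∀ z, ‖z‖ ≤ s → ψ z = 1
  eq_zero : ∀ z, R < ‖z‖ → ψ z = 0

theorem exists_isCutoff {s R : ℝ} (hs : 0 < s) (hR : s < R) : ∃ ψ : ℂ → ℂ, IsCutoff ψ s R := by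
  let f : ContDiffBump (0 : ℂ) := ⟨s, R, hs, hR⟩
  refine ⟨fun z => f z, Complex.ofRealCLM.contDiff.comp f.contDiff, fun z hz => ?_, fun z hz => ?_⟩
  · simp [f.one_of_mem_closedBall (mem_closedBall_zero_iff.2 hz)]
  · simp [f.zero_of_le_dist (x := z) (by simpa using hz.le)]

section Cutoff

variable {ψ : ℂ → ℂ} {s R : ℝ} (hψ : IsCutoff ψ s R)
include hψ

theorem IsCutoff.hasCompactSupport : HasCompactSupport ψ :=
  HasCompactSupport.of_support_subset_isCompact (isCompact_closedBall (0 : ℂ) R) fun z hz => by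
    rw [mem_closedBall_zero_iff]
    by_contra h
    exact hz (hψ.eq_zero z (not_le.1 h))

theorem IsCutoff.wirtingerBar_eq_zero_of_lt {z : ℂ} (hz : ‖z‖ < s) : wirtingerBar ψ z = 0 := by
  have h : ψ =ᶠ[𝓝 z] fun _ => 1 := by
    filter_upwards [Metric.isOpen_ball.mem_nhds (mem_ball_zero_iff.2 hz)] with w hw
    exact hψ.eq_one w (mem_ball_zero_iff.1 hw).le
  simp [wirtingerBar, h.fderiv_eq]

theorem IsCutoff.wirtingerBar_eq_zero {z : ℂ} (hz : R < ‖z‖) : wirtingerBar ψ z = 0 := by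
  have h : ψ =ᶠ[𝓝 z] fun _ => 0 := by
    filter_upwards [(isOpen_lt continuous_const continuous_norm).mem_nhds hz] with w hw
    exact hψ.eq_zero w hw
  simp [wirtingerBar, h.fderiv_eq]

end Cutoff

/-! ### The localised Cauchy–Pompeiu formula in one coordinate of the polydisc. -/

variable {n : ℕ}

/-- The Wirtinger derivative `∂φ/∂z̄_j` of a real differentiable function of several variables. -/
def coordBar (j : Fin n) (φ : (Fin n → ℂ) → ℂ) (z : Fin n → ℂ) : ℂ :=
  (1 / 2 : ℂ) * (fderiv ℝ φ z (Pi.single j 1) + Complex.I * fderiv ℝ φ z (Pi.single j Complex.I))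

theorem wirtingerBar_comp_update {φ : (Fin n → ℂ) → ℂ} (hφ : Differentiable ℝ φ) (j : Fin n)
    (z : Fin n → ℂ) (w : ℂ) :
    wirtingerBar (fun w => φ (update z j w)) w = coordBar j φ (update z j w) := by
  have h : HasFDerivAt (fun w => φ (update z j w))
      ((fderiv ℝ φ (update z j w)).comp (ContinuousLinearMap.single ℝ (fun _ : Fin n => ℂ) j)) w := by
    refine (hφ (update z j w)).hasFDerivAt.comp w ?_
    have h1 := hasFDerivAt_update (𝕜 := ℝ) (i := j) z w
    rwa [show ContinuousLinearMap.pi (Pi.single j (ContinuousLinearMap.id ℝ ℂ)) =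
      ContinuousLinearMap.single ℝ (fun _ : Fin n => ℂ) j from ?_] at h1
    ext v i
    rcases eq_or_ne i j with rfl | hi
    · simp
    · simp [hi]
  simp [wirtingerBar, h.fderiv, coordBar]

theorem wirtingerBar_mul {f g : ℂ → ℂ} (hf : Differentiable ℝ f) (hg : Differentiable ℝ g)
    (z : ℂ) : wirtingerBar (fun w => f w * g w) z =
      wirtingerBar f z * g z + f z * wirtingerBar g z := by
  simp only [wirtingerBar, fderiv_fun_mul (hf z) (hg z)]
  simp
  ring

/-- The Cauchy-Pompeiu formula for `ψ φ` in the coordinate `j`, with `ψ` a cutoff function. -/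
theorem cauchyKernel_reproducing {ψ : ℂ → ℂ} {s R : ℝ} (hψ : IsCutoff ψ s R) (hR : R < 1)
    {φ : (Fin n → ℂ) → ℂ} (hφ : ContDiff ℝ 1 φ) (j : Fin n) {M : ℝ} (hM : ∀ z, ‖φ z‖ ≤ M)
    (hM' : ∀ z, ‖coordBar j φ z‖ ≤ M) (hm : Measurable (coordBar j φ)) {z : Fin n → ℂ}
    (hz : ‖z j‖ ≤ s) :
    coordOp discMeasure (fun x y => cauchyKernel (-wirtingerBar ψ) y x) j φ z -
      coordOp discMeasure (fun x y => cauchyKernel ψ y x) j (coordBar j φ) z = φ z := by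
  have hup : ContDiff ℝ 1 fun w => φ (update z j w) := hφ.comp (contDiff_update 1 z j)
  set g : ℂ → ℂ := fun w => ψ w * φ (update z j w) with hg
  have hgc : ContDiff ℝ 1 g := hψ.contDiff.mul hup
  have hgs : HasCompactSupport g := hψ.hasCompactSupport.mul_right
  have key := integral_inv_sub_mul_wirtingerBar hgc hgs (z j)
  have hwg : ∀ w, wirtingerBar g w =
      wirtingerBar ψ w * φ (update z j w) + ψ w * coordBar j φ (update z j w) := fun w => by
    rw [hg, wirtingerBar_mul (hψ.contDiff.differentiable one_ne_zero)
      (hup.differentiable one_ne_zero), wirtingerBar_comp_update (hφ.differentiable one_ne_zero)]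
  have hwc := continuous_wirtingerBar hψ.contDiff
  have hws := hasCompactSupport_wirtingerBar hψ.hasCompactSupport
  obtain ⟨_, ha⟩ := exists_isSchurKernel_cauchyKernel hψ.contDiff.continuous hψ.hasCompactSupport
  obtain ⟨_, hb⟩ := exists_isSchurKernel_cauchyKernel hwc.neg hws.neg
  have hupm : Measurable fun w => update z j w := measurable_update z
  have i1 := (hb.integrable_left (z j)).mul_bdd (c := M)
    (g := fun w => φ (update z j w)) (hφ.continuous.measurable.comp hupm).aestronglyMeasurable
    (.of_forall fun w => hM _)
  have i2 := (ha.integrable_left (z j)).mul_bdd (c := M)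
    (g := fun w => coordBar j φ (update z j w)) (hm.comp hupm).aestronglyMeasurable
    (.of_forall fun w => hM' _)
  simp only [coordOp]
  -- By the product rule the two integrands combine into the Cauchy kernel times `∂(ψφ)/∂z̄`. Since
  -- `R < 1`, this vanishes off the unit disc, so the integral extends to the whole plane.
  rw [← integral_sub i1 i2, setIntegral_eq_integral_of_forall_compl_eq_zero]
  · have hpi : (Real.pi : ℂ) ≠ 0 := by exact_mod_cast Real.pi_ne_zero
    calc _ = ∫ w, -(Real.pi : ℂ)⁻¹ * ((w - z j)⁻¹ * wirtingerBar g w) := by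
          congr 1; ext w; rw [hwg]; simp only [cauchyKernel, Pi.neg_apply]; ring
      _ = _ := by
          rw [integral_const_mul, key, hg]
          simp only [hψ.eq_one _ hz, update_eq_self]
          field_simp
  · intro w hw
    have hw' : R < ‖w‖ := hR.trans_le (by simpa using hw)
    simp [cauchyKernel, hψ.wirtingerBar_eq_zero hw', hψ.eq_zero w hw']

theorem continuous_coordBar {φ : (Fin n → ℂ) → ℂ} (hφ : ContDiff ℝ 1 φ) (j : Fin n) :
    Continuous (coordBar j φ) := by
  have h := hφ.continuous_fderiv one_ne_zero
  unfold coordBar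
  fun_prop

theorem IsSchurKernel.transpose {X : Type*} [MeasurableSpace X] {ν : Measure X}
    {k : X → X → ℂ} {C : NNReal} (hk : IsSchurKernel ν k C) :
    IsSchurKernel ν (fun x y => k y x) C :=
  ⟨hk.measurable.comp measurable_swap, hk.lintegral_right, hk.lintegral_left⟩

theorem integrable_mul_coordOp {X : Type*} [MeasurableSpace X] {ν : Measure X} [IsFiniteMeasure ν]
    {k : X → X → ℂ} {C : NNReal} (hk : IsSchurKernel ν k C) (j : Fin n) {μ : Measure (Fin n → X)}
    {f φ : (Fin n → X) → ℂ} (hf : Integrable f μ) (hφ : Measurable φ) {M : ℝ}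
    (hM : ∀ z, ‖φ z‖ ≤ M) : Integrable (fun z => f z * coordOp ν k j φ z) μ := by
  refine hf.mul_bdd (c := C * M.toNNReal) (measurable_coordOp hk j hφ).aestronglyMeasurable
    (.of_forall fun z => ?_)
  have h := norm_coordOp_le hk j (f := φ) (M := M.toNNReal) (z := z) (.of_forall fun w => by
    rw [← ofReal_norm]; exact ENNReal.ofReal_le_ofReal (hM _))
  rw [← toReal_enorm]
  exact ENNReal.toReal_mono (ENNReal.mul_ne_top ENNReal.coe_ne_top ENNReal.coe_ne_top) h |>.trans
    (by simp)

/-- One step of the telescoping argument: in the coordinate `j`, `f` is the sum of a `∂/∂z̄_j`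
derivative and of a remainder. -/
theorem integral_mul_eq_sub {ψ : ℂ → ℂ} {s R : ℝ} (hψ : IsCutoff ψ s R) (hR : R < 1)
    {φ : (Fin n → ℂ) → ℂ} (hφ : ContDiff ℝ 1 φ) (hφs : HasCompactSupport φ) (j : Fin n)
    {f : (Fin n → ℂ) → ℂ} (hf : Integrable f (polydiscMeasure n))
    (hfs : ∀ᵐ z ∂polydiscMeasure n, z j ∉ Metric.closedBall (0 : ℂ) s → f z = 0) :
    ∫ z, f z * φ z ∂polydiscMeasure n =
      ∫ z, coordOp discMeasure (cauchyKernel (-wirtingerBar ψ)) j f z * φ z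
          ∂polydiscMeasure n -
      ∫ z, coordOp discMeasure (cauchyKernel ψ) j f z * coordBar j φ z ∂polydiscMeasure n := by
  have hcb := continuous_coordBar hφ j
  have hcs : HasCompactSupport (coordBar j φ) := by
    refine (hφs.fderiv ℝ).mono' (subset_closure.trans' fun z hz => ?_)
    contrapose! hz
    have : fderiv ℝ φ z = 0 := by simpa using hz
    simp [coordBar, this]
  obtain ⟨M₁, hM₁⟩ := hφ.continuous.bounded_above_of_compact_support hφs
  obtain ⟨M₂, hM₂⟩ := hcb.bounded_above_of_compact_support hcs
  have hwc := continuous_wirtingerBar hψ.contDiff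
  have hws := hasCompactSupport_wirtingerBar hψ.hasCompactSupport
  obtain ⟨_, ha⟩ := exists_isSchurKernel_cauchyKernel hψ.contDiff.continuous hψ.hasCompactSupport
  obtain ⟨_, hb⟩ := exists_isSchurKernel_cauchyKernel hwc.neg hws.neg
  have hμ := polydiscMeasure_eq_pi n
  have e1 := integral_coordOp_mul hμ hb j hf hφ.continuous.measurable hM₁
  have e2 := integral_coordOp_mul hμ ha j hf hcb.measurable hM₂
  have i1 := integrable_mul_coordOp hb.transpose j hf hφ.continuous.measurable hM₁
  have i2 := integrable_mul_coordOp ha.transpose j hf hcb.measurable hM₂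
  -- With both operators moved onto the test function, the reproducing formula applies wherever
  -- `|z_j| ≤ s`; elsewhere `f` is zero.
  rw [e1, e2, ← integral_sub i1 i2]
  refine integral_congr_ae ?_
  filter_upwards [hfs] with z hz
  by_cases h : ‖z j‖ ≤ s
  · rw [← mul_sub, cauchyKernel_reproducing hψ hR hφ j (M := max M₁ M₂)
      (fun z => (hM₁ z).trans (le_max_left _ _)) (fun z => (hM₂ z).trans (le_max_right _ _))
      hcb.measurable h]
  · simp [hz (by simpa using h)]

/-! ### Vanishing moments and their propagation from one coordinate to the next. -/

/-- A function with vanishing moments in the coordinate `j`, supported in a disc of that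
coordinate, is orthogonal to the Cauchy kernels with poles off that disc. -/
theorem integral_mul_inv_sub_eq_zero {μ : Measure (Fin n → ℂ)} {F : (Fin n → ℂ) → ℂ}
    (hF : Integrable F μ) (j : Fin n) {ρ : ℝ} (hρ : 0 ≤ ρ) (hρ1 : ρ < 1)
    (hFs : ∀ᵐ z ∂μ, z j ∉ Metric.closedBall (0 : ℂ) ρ → F z = 0)
    (hmom : ∀ k : ℕ, ∫ z, F z * (Metric.ball (0 : ℂ) 1).indicator id (z j) ^ k ∂μ = 0)
    {u : ℂ} (hu : ρ < ‖u‖) : ∫ z, F z * (u - z j)⁻¹ ∂μ = 0 := by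
  have hu0 : u ≠ 0 := norm_pos_iff.1 (hρ.trans_lt hu)
  have hq : ρ / ‖u‖ < 1 := (div_lt_one (hρ.trans_lt hu)).2 hu
  have hq0 : 0 ≤ ρ / ‖u‖ := by positivity
  -- Truncating the identity keeps all powers bounded, and changes nothing on `|w| ≤ ρ`, where `F`
  -- lives.
  set t : ℂ → ℂ := (Metric.ball (0 : ℂ) 1).indicator id with ht
  have htm : Measurable t := measurable_id.indicator Metric.isOpen_ball.measurableSet
  have htz : ∀ w : ℂ, ‖w‖ ≤ ρ → t w = w := fun w hw => by
    rw [ht, indicator_of_mem (mem_ball_zero_iff.2 (hw.trans_lt hρ1)), id]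
  -- Termwise integration of `1/(u - z) = ∑ z^k / u^{k+1}`, dominated by a geometric series of ratio
  -- `ρ/|u| < 1`.
  have hsum := hasSum_integral_of_dominated_convergence (μ := μ)
    (F := fun (k : ℕ) z => F z * t (z j) ^ k * (u ^ (k + 1))⁻¹)
    (f := fun z => F z * (u - z j)⁻¹) (bound := fun k z => ‖F z‖ * ‖u‖⁻¹ * (ρ / ‖u‖) ^ k)
    (fun k => ((hF.aestronglyMeasurable.mul
      ((htm.comp (measurable_pi_apply j)).pow_const k).aestronglyMeasurable).mul
        aestronglyMeasurable_const)) ?_ ?_ ?_ ?_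
  · refine hsum.unique ?_
    have : ∀ k : ℕ, ∫ z, F z * t (z j) ^ k * (u ^ (k + 1))⁻¹ ∂μ = 0 := fun k => by
      rw [integral_mul_const, hmom k, zero_mul]
    simp only [this]
    exact hasSum_zero
  · intro k
    filter_upwards [hFs] with z hz
    by_cases h : ‖z j‖ ≤ ρ
    · rw [htz _ h, norm_mul, norm_mul, norm_inv, norm_pow, norm_pow, div_pow, pow_succ, mul_inv]
      calc _ = ‖F z‖ * ‖u‖⁻¹ * (‖z j‖ ^ k * (‖u‖ ^ k)⁻¹) := by ring
        _ ≤ ‖F z‖ * ‖u‖⁻¹ * (ρ ^ k * (‖u‖ ^ k)⁻¹) := by gcongr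
        _ = _ := by rw [div_eq_mul_inv]
    · simp [hz (by simpa using h)]
  · exact .of_forall fun z => (summable_geometric_of_lt_one hq0 hq).mul_left _
  · simp only [tsum_mul_left]
    exact (hF.norm.mul_const _).mul_const _
  · filter_upwards [hFs] with z hz
    by_cases h : ‖z j‖ ≤ ρ
    · have h1 : ‖z j / u‖ < 1 := by
        rw [norm_div]; exact (div_lt_one (hρ.trans_lt hu)).2 (h.trans_lt hu)
      have h2 := ((hasSum_geometric_of_norm_lt_one h1).mul_left (F z * u⁻¹))
      have hne : u - z j ≠ 0 := fun h0 => by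
        rw [sub_eq_zero] at h0; rw [← h0] at h; exact absurd hu (not_lt.2 h)
      rw [show F z * u⁻¹ * (1 - z j / u)⁻¹ = F z * (u - z j)⁻¹ by
        rw [mul_assoc, ← mul_inv, mul_sub, mul_one, mul_div_cancel₀ _ hu0]] at h2
      have e : ∀ k : ℕ, F z * u⁻¹ * (z j / u) ^ k = F z * t (z j) ^ k * (u ^ (k + 1))⁻¹ := fun k => by
        rw [htz _ h, div_pow, pow_succ]
        field_simp
      simpa only [e] using h2
    · simp [hz (by simpa using h)]

/-- The monomial `∏_{i ≥ m} z_i ^ α_i` on the polydisc, extended by zero. -/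
def tailMonomial (m : ℕ) (α : Fin n → ℕ) (z : Fin n → ℂ) : ℂ :=
  ∏ i : Fin n, if m ≤ i then (Metric.ball (0 : ℂ) 1).indicator id (z i) ^ α i else 1

theorem measurable_tailMonomial (m : ℕ) (α : Fin n → ℕ) : Measurable (tailMonomial m α) := by
  refine Finset.measurable_prod _ fun i _ => ?_
  split_ifs
  · exact (((measurable_id.indicator Metric.isOpen_ball.measurableSet).comp
      (measurable_pi_apply i))).pow_const _
  · exact measurable_const

theorem norm_tailMonomial_le (m : ℕ) (α : Fin n → ℕ) (z : Fin n → ℂ) :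
    ‖tailMonomial m α z‖ ≤ 1 := by
  rw [tailMonomial, norm_prod]
  refine Finset.prod_le_one (fun _ _ => norm_nonneg _) fun i _ => ?_
  split_ifs
  · rw [norm_pow]
    refine pow_le_one₀ (norm_nonneg _) ?_
    by_cases h : z i ∈ Metric.ball (0 : ℂ) 1
    · rw [indicator_of_mem h]; exact (mem_ball_zero_iff.1 h).le
    · rw [indicator_of_notMem h]; simp
  · simp

theorem tailMonomial_succ_update {m : ℕ} (h : m < n) (α : Fin n → ℕ) (z : Fin n → ℂ) (w : ℂ) :
    tailMonomial (m + 1) α (update z ⟨m, h⟩ w) = tailMonomial (m + 1) α z := by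
  refine Finset.prod_congr rfl fun i _ => ?_
  split_ifs with hi
  · rw [update_of_ne]
    rintro rfl
    simp at hi
  · rfl

theorem tailMonomial_update {m : ℕ} (h : m < n) (α : Fin n → ℕ) (k : ℕ) (z : Fin n → ℂ) :
    tailMonomial m (update α ⟨m, h⟩ k) z =
      tailMonomial (m + 1) α z * (Metric.ball (0 : ℂ) 1).indicator id (z ⟨m, h⟩) ^ k := by
  rw [tailMonomial, tailMonomial, ← Finset.mul_prod_erase _ _ (Finset.mem_univ ⟨m, h⟩),
    ← Finset.mul_prod_erase _ _ (Finset.mem_univ (⟨m, h⟩ : Fin n))]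
  simp only [le_refl, if_true, update_self, Nat.not_succ_le_self, if_false, one_mul]
  rw [mul_comm]
  congr 1
  refine Finset.prod_congr rfl fun i hi => ?_
  have hne := Finset.ne_of_mem_erase hi
  rw [update_of_ne hne]
  have : (m ≤ i.1) ↔ (m + 1 ≤ i.1) := by
    have : i.1 ≠ m := fun h0 => hne (Fin.ext h0)
    omega
  simp only [this]

/-- All moments of `f` in the coordinates of index at least `m` vanish, for every value of the
other coordinates. -/
def HasVanishingMoments (m : ℕ) (f : (Fin n → ℂ) → ℂ) : Prop :=
  ∀ (φ : (Fin n → ℂ) → ℂ) (M : ℝ) (α : Fin n → ℕ), Measurable φ → (∀ z, ‖φ z‖ ≤ M) →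
    (∀ i : Fin n, m ≤ i → ∀ z w, φ (update z i w) = φ z) →
    ∫ z, f z * φ z * tailMonomial m α z ∂polydiscMeasure n = 0

/-- By duality and Fubini, the pairing is an integral over the pole `w` of pairings of `f` with a
Cauchy kernel in the coordinate `m`. For `|w| < s` the factor `∂ψ/∂z̄` vanishes; for `|w| ≥ s > ρ`
the pole is off the support of `f`, and the expansion of the kernel reduces everything to moments of
`f`. -/
theorem HasVanishingMoments.coordOp_succ {ψ : ℂ → ℂ} {s R : ℝ} (hψ : IsCutoff ψ s R)
    {ρ : ℝ} (hρ : 0 ≤ ρ) (hρs : ρ < s) (hs1 : s < 1) {m : ℕ} (h : m < n) {f : (Fin n → ℂ) → ℂ}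
    (hf : Integrable f (polydiscMeasure n))
    (hfs : ∀ᵐ z ∂polydiscMeasure n, z ⟨m, h⟩ ∉ Metric.closedBall (0 : ℂ) ρ → f z = 0)
    (hmom : HasVanishingMoments m f) :
    HasVanishingMoments (m + 1)
      (coordOp discMeasure (cauchyKernel (-wirtingerBar ψ)) ⟨m, h⟩ f) := by
  intro φ M α hφ hM hdep
  set j : Fin n := ⟨m, h⟩ with hj
  set Φ : (Fin n → ℂ) → ℂ := fun z => φ z * tailMonomial (m + 1) α z with hΦ
  have hΦm : Measurable Φ := hφ.mul (measurable_tailMonomial _ _)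
  have hM0 : 0 ≤ M := (norm_nonneg _).trans (hM 0)
  have hΦM : ∀ z, ‖Φ z‖ ≤ M := fun z => by
    rw [hΦ, norm_mul, ← mul_one M]
    gcongr
    · exact hM z
    · exact norm_tailMonomial_le _ _ _
  have hwc := continuous_wirtingerBar hψ.contDiff
  have hws := hasCompactSupport_wirtingerBar hψ.hasCompactSupport
  obtain ⟨_, hb⟩ := exists_isSchurKernel_cauchyKernel hwc.neg hws.neg
  have hμ := polydiscMeasure_eq_pi n
  simp only [mul_assoc]
  rw [integral_coordOp_mul hμ hb j hf hΦm hΦM]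
  have hint : Integrable (fun p : (Fin n → ℂ) × ℂ => cauchyKernel (-wirtingerBar ψ) p.2 (p.1 j) *
      f p.1 * Φ (update p.1 j p.2)) ((polydiscMeasure n).prod discMeasure) :=
    (integrable_transposed hμ hb j hf).mul_bdd (c := M)
      (hΦm.comp measurable_update').aestronglyMeasurable (.of_forall fun p => hΦM _)
  calc _ = ∫ z, ∫ w, cauchyKernel (-wirtingerBar ψ) w (z j) * f z * Φ (update z j w)
        ∂discMeasure ∂polydiscMeasure n := by
        congr 1; ext z
        simp only [coordOp]
        rw [← integral_const_mul]
        congr 1; ext w; ring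
    _ = ∫ w, ∫ z, cauchyKernel (-wirtingerBar ψ) w (z j) * f z * Φ (update z j w)
        ∂polydiscMeasure n ∂discMeasure := integral_integral_swap hint
    _ = ∫ w, 0 ∂discMeasure := by
        congr 1; ext w
        by_cases hw : ‖w‖ < s
        · simp [cauchyKernel, hψ.wirtingerBar_eq_zero_of_lt hw]
        · have hφw : Measurable fun z => φ (update z j w) := hφ.comp (measurable_update_left)
          have hF : Integrable (fun z => f z * (φ (update z j w) * tailMonomial (m + 1) α z))
              (polydiscMeasure n) := by
            refine hf.mul_bdd (c := M) (hφw.mul (measurable_tailMonomial _ _)).aestronglyMeasurable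
              (.of_forall fun z => ?_)
            rw [← tailMonomial_succ_update h α z w]
            exact hΦM _
          have hzero := integral_mul_inv_sub_eq_zero hF j hρ (hρs.trans hs1)
            (hfs.mono fun z hz hzj => by rw [hz hzj, zero_mul]) (fun k => ?_)
            (hρs.trans_le (not_lt.1 hw))
          · calc _ = ∫ z, ((Real.pi : ℂ)⁻¹ * (-wirtingerBar ψ) w) *
                  (f z * (φ (update z j w) * tailMonomial (m + 1) α z) * (w - z j)⁻¹)
                  ∂polydiscMeasure n := by
                  congr 1; ext z
                  simp only [hΦ, cauchyKernel, hj, tailMonomial_succ_update h]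
                  ring
              _ = 0 := by rw [integral_const_mul, hzero, mul_zero]
          -- Freezing the coordinate `m` at `w` makes the test function independent of all
          -- coordinates of index at least `m`. The power `k` from the expansion becomes the
          -- exponent of `z_m` in the monomial.
          · have := hmom (fun z => φ (update z j w)) M (update α j k) hφw (fun z => hM _) ?_
            · refine Eq.trans ?_ this
              congr 1; ext z
              rw [tailMonomial_update h]
              ring
            · intro i hi z v
              rcases eq_or_ne i j with rfl | hij
              · simp
              · change φ (update (update z i v) j w) = φ (update z j w)
                rw [update_comm hij, hdep i]
                have : i.1 ≠ m := fun h0 => hij (Fin.ext h0)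
                omega
    _ = 0 := by simp

/-! ### Orthogonality of `∂̄T` to holomorphic functions. -/

variable {q : ℕ}

theorem lineDerivOp_testFunction_apply {Ω : Opens (Fin n → ℂ)} (φ : 𝓓(Ω, ℝ)) (v z : Fin n → ℂ) :
    (∂_{v} φ : 𝓓(Ω, ℝ)) z = fderiv ℝ φ z v := by
  rw [TestFunction.lineDerivOp_eq_lineDerivCLM ℝ, TestFunction.lineDerivCLM_apply]
  rw [if_pos (by simp), DifferentiableAt.lineDeriv_eq_fderiv]
  exact (φ.contDiff.differentiable (by simp)).differentiableAt

theorem dbarCoord_apply {Ω : Opens (Fin n → ℂ)} (k : Fin n) (T : 𝓓'(Ω, ℂ)) (φ : 𝓓(Ω, ℝ)) :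
    dbarCoord Ω k T φ = -(1 / 2 : ℂ) * (T (∂_{(Pi.single k 1 : Fin n → ℂ)} φ) +
      Complex.I * T (∂_{(Pi.single k Complex.I : Fin n → ℂ)} φ)) := by
  change (1 / 2 : ℂ) • ((∂_{(Pi.single k 1 : Fin n → ℂ)} T) φ +
    Complex.I • (∂_{(Pi.single k Complex.I : Fin n → ℂ)} T) φ) = _
  rw [Distribution.lineDerivOp_apply_apply, Distribution.lineDerivOp_apply_apply, map_neg, map_neg]
  simp only [smul_eq_mul]
  ring

theorem dbar_apply (Ω : Opens (Fin n → ℂ)) (T : Current Ω q) (I : MultiIndex n (q + 1))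
    (φ : 𝓓(Ω, ℝ)) : dbar Ω q T I φ = ∑ k : {k // k ∈ I.1},
      (-1 : ℂ) ^ (I.1.filter (· < k.1)).card * dbarCoord Ω k.1 (T (I.erase k.1 k.2)) φ := by
  change (∑ k : {k // k ∈ I.1}, (-1 : ℂ) ^ (I.1.filter (· < k.1)).card •
    dbarCoord Ω k.1 (T (I.erase k.1 k.2))) φ = _
  induction (Finset.univ : Finset {k // k ∈ I.1}) using Finset.induction_on with
  | empty => simp
  | insert a s ha ih =>
    rw [Finset.sum_insert ha, Finset.sum_insert ha, ← ih]
    rfl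

theorem toCurrent_apply (Ω : Opens (Fin n → ℂ)) (r : ℝ≥0∞) [Fact (1 ≤ r)] (ω : LpForm Ω q r)
    (J : MultiIndex n q) (φ : 𝓓(Ω, ℝ)) : LpForm.toCurrent Ω q r ω J φ =
      ∫ z in (Ω : Set (Fin n → ℂ)), (φ z : ℂ) * ω J z :=
  distributionOfFun_apply Ω r (ω J) φ

theorem exists_testFunction_eq_one {Ω : Opens (Fin n → ℂ)} {K : Set (Fin n → ℂ)}
    (hK : IsCompact K) (hKΩ : K ⊆ Ω) : ∃ χ : 𝓓(Ω, ℝ), ∃ U : Set (Fin n → ℂ), IsOpen U ∧ K ⊆ U ∧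
      ∀ z ∈ U, χ z = 1 := by
  obtain ⟨L, hL, hKL, hLΩ⟩ := exists_compact_between hK Ω.isOpen hKΩ
  obtain ⟨f, h1, h0, -⟩ := exists_contMDiffMap_one_nhds_of_subset_interior
    (n := ⊤) 𝓘(ℝ, Fin n → ℂ) hK.isClosed hKL
  have hsub : support f ⊆ L := fun z hz => by
    by_contra h
    exact hz (h0 z h)
  have hts : tsupport f ⊆ L := closure_minimal hsub hL.isClosed
  rw [Filter.Eventually, mem_nhdsSet_iff_exists] at h1
  obtain ⟨U, hU, hKU, hUf⟩ := h1
  exact ⟨⟨f, f.contMDiff.contDiff, hL.of_isClosed_subset (isClosed_tsupport _) hts,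
    hts.trans hLΩ⟩, U, hU, hKU, fun z hz => hUf hz⟩

/-- The product of a test function with a smooth function. -/
def testFunctionMul {Ω : Opens (Fin n → ℂ)} (χ : 𝓓(Ω, ℝ)) {g : (Fin n → ℂ) → ℝ}
    (hg : ContDiff ℝ (⊤ : ℕ∞) g) : 𝓓(Ω, ℝ) :=
  ⟨fun z => χ z * g z, χ.contDiff.mul hg, χ.hasCompactSupport.mul_right,
    (tsupport_mul_subset_left).trans χ.tsupport_subset⟩

theorem fderiv_testFunctionMul {Ω : Opens (Fin n → ℂ)} {χ : 𝓓(Ω, ℝ)} {g : (Fin n → ℂ) → ℝ}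
    (hg : ContDiff ℝ (⊤ : ℕ∞) g) {U : Set (Fin n → ℂ)} (hU : IsOpen U) (hχ : ∀ z ∈ U, χ z = 1)
    {z : Fin n → ℂ} (hz : z ∈ U) : fderiv ℝ (testFunctionMul χ hg) z = fderiv ℝ g z := by
  refine Filter.EventuallyEq.fderiv_eq ?_
  filter_upwards [hU.mem_nhds hz] with w hw
  change χ w * g w = g w
  rw [hχ w hw, one_mul]

/-- `∂S/∂z̄_k` is orthogonal to the functions which are holomorphic near the support of `S`. -/
theorem dbarCoord_holomorphic_eq_zero {Ω : Opens (Fin n → ℂ)} (k : Fin n) {S : 𝓓'(Ω, ℂ)}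
    {K U : Set (Fin n → ℂ)} (hS : Distribution.IsVanishingOn S Kᶜ) (hU : IsOpen U) (hKU : K ⊆ U)
    {χ : 𝓓(Ω, ℝ)} (hχ : ∀ z ∈ U, χ z = 1) {g : (Fin n → ℂ) → ℂ} (hg : Differentiable ℂ g)
    (hre : ContDiff ℝ (⊤ : ℕ∞) fun z => (g z).re) (him : ContDiff ℝ (⊤ : ℕ∞) fun z => (g z).im) :
    dbarCoord Ω k S (testFunctionMul χ hre) +
      Complex.I * dbarCoord Ω k S (testFunctionMul χ him) = 0 := by
  set u := testFunctionMul χ hre with hu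
  set v := testFunctionMul χ him with hv
  set e : Fin n → ℂ := Pi.single k 1 with he
  set e' : Fin n → ℂ := Pi.single k Complex.I with he'
  have hee : e' = Complex.I • e := by
    rw [he, he', ← Pi.single_smul]; simp
  have hfr : ∀ z w, fderiv ℝ (fun z => (g z).re) z w = (fderiv ℂ g z w).re := fun z w => by
    have h := (hg z).hasFDerivAt.restrictScalars ℝ
    exact congrArg (fun L => L w) (Complex.reCLM.hasFDerivAt.comp z h).fderiv
  have hfi : ∀ z w, fderiv ℝ (fun z => (g z).im) z w = (fderiv ℂ g z w).im := fun z w => by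
    have h := (hg z).hasFDerivAt.restrictScalars ℝ
    exact congrArg (fun L => L w) (Complex.imCLM.hasFDerivAt.comp z h).fderiv
  have hvan : ∀ φ : 𝓓(Ω, ℝ), (∀ z ∈ U, φ z = 0) → S φ = 0 := fun φ hφ => by
    refine hS φ fun z hz hzK => ?_
    have : tsupport φ ⊆ Uᶜ := closure_minimal (fun w hw hwU => hw (hφ w hwU)) hU.isClosed_compl
    exact this hz (hKU hzK)
  -- Test functions are real valued, so `g` enters through its real and imaginary parts. The
  -- expressions in `h1` and `h2` are the Cauchy–Riemann equations in the coordinate `k`; they hold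
  -- on `U`, where the cutoff is `1`.
  have h1 : S (∂_{e} u - ∂_{e'} v) = 0 := hvan _ fun z hz => by
    change (∂_{e} u : 𝓓(Ω, ℝ)) z - (∂_{e'} v : 𝓓(Ω, ℝ)) z = 0
    rw [lineDerivOp_testFunction_apply, lineDerivOp_testFunction_apply,
      fderiv_testFunctionMul hre hU hχ hz, fderiv_testFunctionMul him hU hχ hz, hfr, hfi, hee,
      map_smul]
    simp
  have h2 : S (∂_{e'} u + ∂_{e} v) = 0 := hvan _ fun z hz => by
    change (∂_{e'} u : 𝓓(Ω, ℝ)) z + (∂_{e} v : 𝓓(Ω, ℝ)) z = 0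
    rw [lineDerivOp_testFunction_apply, lineDerivOp_testFunction_apply,
      fderiv_testFunctionMul hre hU hχ hz, fderiv_testFunctionMul him hU hχ hz, hfr, hfi, hee,
      map_smul]
    simp
  rw [map_sub] at h1
  rw [map_add] at h2
  rw [dbarCoord_apply, dbarCoord_apply]
  linear_combination (-(1 / 2 : ℂ)) * h1 - (1 / 2 : ℂ) * Complex.I * h2 -
    (1 / 2 : ℂ) * S (∂_{e'} v) * Complex.I_sq

/-- The coefficients of `∂̄T`, for `T` with compact support, are orthogonal to the holomorphic
functions. -/
theorem integral_mul_holomorphic_eq_zero {Ω : Opens (Fin n → ℂ)} {r : ℝ≥0∞} [Fact (1 ≤ r)]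
    {K : Set (Fin n → ℂ)} (hK : IsCompact K) (hKΩ : K ⊆ Ω) {ω : LpForm Ω (q + 1) r}
    (hω : ω ∈ LpForm.supportedIn Ω (q + 1) r K) {T : Current Ω q} (hT : T.HasCompactSupport)
    (hTω : dbar Ω q T = LpForm.toCurrent Ω (q + 1) r ω) {g : (Fin n → ℂ) → ℂ}
    (hg : Differentiable ℂ g) (hgc : ContDiff ℝ (⊤ : ℕ∞) g) (I : MultiIndex n (q + 1)) :
    ∫ z in (Ω : Set (Fin n → ℂ)), ω I z * g z = 0 := by
  obtain ⟨A, hA, hAΩ, hTA⟩ := hT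
  -- The cutoff must be `1` near the support of `T`, for the Cauchy–Riemann equations, and on `K`,
  -- so that the pairing with `ω` sees `g` itself.
  obtain ⟨χ, U, hU, hKU, hχ⟩ := exists_testFunction_eq_one (hK.union hA) (union_subset hKΩ hAΩ)
  have hre : ContDiff ℝ (⊤ : ℕ∞) fun z => (g z).re := Complex.reCLM.contDiff.comp hgc
  have him : ContDiff ℝ (⊤ : ℕ∞) fun z => (g z).im := Complex.imCLM.contDiff.comp hgc
  have h1 : dbar Ω q T I (testFunctionMul χ hre) +
      Complex.I * dbar Ω q T I (testFunctionMul χ him) = 0 := by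
    rw [dbar_apply, dbar_apply, Finset.mul_sum, ← Finset.sum_add_distrib]
    refine Finset.sum_eq_zero fun k _ => ?_
    have := dbarCoord_holomorphic_eq_zero k.1 (hTA (I.erase k.1 k.2)) hU
      (subset_union_right.trans hKU) hχ hg hre him
    linear_combination (-1 : ℂ) ^ (I.1.filter (· < k.1)).card * this
  rw [hTω, toCurrent_apply, toCurrent_apply, ← integral_const_mul] at h1
  have hi : ∀ φ : 𝓓(Ω, ℝ), Integrable (fun z => (φ z : ℂ) * ω I z)
      (volume.restrict (Ω : Set (Fin n → ℂ))) := fun φ => by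
    simpa using TestFunction.integrable_bilin (ContinuousLinearMap.lsmul ℝ ℝ)
        ((locallyIntegrable_Lp Ω r (ω I)).locallyIntegrableOn _) φ
  rw [← integral_add (hi _) ((hi _).const_mul _)] at h1
  rw [← h1]
  refine integral_congr_ae ?_
  filter_upwards [hω I] with z hz
  by_cases hzK : z ∈ K
  · have e1 : testFunctionMul χ hre z = (g z).re := by
      change χ z * (g z).re = _
      rw [hχ z (hKU (Or.inl hzK)), one_mul]
    have e2 : testFunctionMul χ him z = (g z).im := by
      change χ z * (g z).im = _
      rw [hχ z (hKU (Or.inl hzK)), one_mul]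
    simp only [e1, e2]
    conv_lhs => rw [← Complex.re_add_im (g z)]
    ring
  · simp [hz hzK]

/-! ### The two ends of the moment condition, and the telescoping sum. -/

theorem HasVanishingMoments.congr_ae {m : ℕ} {f g : (Fin n → ℂ) → ℂ}
    (hf : HasVanishingMoments m f) (h : g =ᵐ[polydiscMeasure n] f) : HasVanishingMoments m g := by
  intro φ M α hφ hM hdep
  rw [← hf φ M α hφ hM hdep]
  exact integral_congr_ae (h.mono fun z hz => by simp only [hz])

theorem eq_of_forall_update_eq {ι X Y : Type*} [Fintype ι] [DecidableEq ι] {φ : (ι → X) → Y}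
    (h : ∀ i z w, φ (update z i w) = φ z) (z z' : ι → X) : φ z' = φ z := by
  have : ∀ s : Finset ι, φ (s.piecewise z' z) = φ z := fun s => by
    induction s using Finset.induction_on with
    | empty => simp
    | insert a s _ ih => rw [Finset.piecewise_insert, h, ih]
  simpa using this Finset.univ

/-- At level `0` the test function depends on no coordinate, hence is constant, and only the
pairings with monomials remain. -/
theorem hasVanishingMoments_zero {f : (Fin n → ℂ) → ℂ}
    (h : ∀ g : (Fin n → ℂ) → ℂ, Differentiable ℂ g → ContDiff ℝ (⊤ : ℕ∞) g →
      ∫ z, f z * g z ∂polydiscMeasure n = 0) : HasVanishingMoments 0 f := by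
  intro φ M α hφ hM hdep
  have h1 := h (fun z => ∏ i, z i ^ α i) (by fun_prop)
    (contDiff_prod fun i _ => (contDiff_apply ℝ ℂ i).pow _)
  calc _ = ∫ z, φ 0 * (f z * ∏ i, z i ^ α i) ∂polydiscMeasure n := by
        refine integral_congr_ae ?_
        filter_upwards [ae_restrict_mem (polydisc n).isOpen.measurableSet] with z hz
        rw [eq_of_forall_update_eq (fun i => hdep i (Nat.zero_le _)) 0 z, mul_comm (f z), mul_assoc]
        congr 2
        refine Finset.prod_congr rfl fun i _ => ?_
        rw [if_pos (Nat.zero_le _), indicator_of_mem (mem_ball_zero_iff.2 (hz i)), id]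
    _ = 0 := by rw [integral_const_mul, h1, mul_zero]

/-- At level `n` no coordinate is left to constrain `φ` and the monomial is empty. This is how the
final remainder disappears. -/
theorem HasVanishingMoments.integral_mul_eq_zero {f : (Fin n → ℂ) → ℂ}
    (hf : HasVanishingMoments n f) {φ : (Fin n → ℂ) → ℂ} (hφ : Measurable φ) {M : ℝ}
    (hM : ∀ z, ‖φ z‖ ≤ M) : ∫ z, f z * φ z ∂polydiscMeasure n = 0 := by
  have h := hf φ M 0 hφ hM fun i hi => absurd i.2 (not_lt.2 hi)
  simpa [tailMonomial] using h

/-- The functions obtained from `F 0` by applying, one coordinate after the other, the integral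
operators with kernel `b`. -/
structure IsIteration (b : ℂ → ℂ → ℂ) (F : ℕ → (Fin n → ℂ) → ℂ) : Prop where
  integrable : ∀ m, Integrable (F m) (polydiscMeasure n)
  succ : ∀ m (h : m < n), F (m + 1) =ᵐ[polydiscMeasure n] coordOp discMeasure b ⟨m, h⟩ (F m)

namespace IsIteration

variable {ψ : ℂ → ℂ} {s R ρ : ℝ} (hψ : IsCutoff ψ s R) {F : ℕ → (Fin n → ℂ) → ℂ}
  (hF : IsIteration (cauchyKernel (-wirtingerBar ψ)) F)
  (hsupp : ∀ i, ∀ᵐ z ∂polydiscMeasure n, z i ∉ Metric.closedBall (0 : ℂ) ρ → F 0 z = 0)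

-- Coordinates not yet treated keep the radius `ρ`. Both the decomposition in the next coordinate
-- and the expansion of its Cauchy kernel rely on this.
include hF hsupp in
theorem support_of_le {m : ℕ} (hm : m ≤ n) (i : Fin n) (hi : m ≤ i) :
    ∀ᵐ z ∂polydiscMeasure n, z i ∉ Metric.closedBall (0 : ℂ) ρ → F m z = 0 := by
  induction m with
  | zero => exact hsupp i
  | succ m ih =>
    have hne : i ≠ ⟨m, hm⟩ := fun h => by rw [h] at hi; simp at hi
    filter_upwards [hF.succ m hm, coordOp_ae_eq_zero_of_ne (k := cauchyKernel (-wirtingerBar ψ))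
      (polydiscMeasure_eq_pi n) ⟨m, hm⟩ hne (ih (by omega) (by omega))] with z h1 h2 h3
    rw [h1, h2 h3]

-- A treated coordinate is confined to radius `R` by the factor `∂ψ/∂z̄`, and operators in the other
-- coordinates do not enlarge its support again.
include hψ hF hsupp in
theorem support {m : ℕ} (hρR : ρ ≤ R) (hm : m ≤ n) (i : Fin n) :
    ∀ᵐ z ∂polydiscMeasure n, z i ∉ Metric.closedBall (0 : ℂ) R → F m z = 0 := by
  induction m with
  | zero =>
    exact (hsupp i).mono fun z hz h => hz fun h1 => h (Metric.closedBall_subset_closedBall hρR h1)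
  | succ m ih =>
    rcases eq_or_ne i ⟨m, hm⟩ with rfl | hne
    · filter_upwards [hF.succ m hm] with z h1 h2
      rw [h1]
      simp [coordOp, cauchyKernel, hψ.wirtingerBar_eq_zero (z := z ⟨m, hm⟩) (by simpa using h2)]
    · filter_upwards [hF.succ m hm, coordOp_ae_eq_zero_of_ne (k := cauchyKernel (-wirtingerBar ψ))
        (polydiscMeasure_eq_pi n) ⟨m, hm⟩ hne (ih (by omega))] with z h1 h2 h3
      rw [h1, h2 h3]

include hψ hF hsupp in
theorem coordOp_support (hρR : ρ ≤ R) (j i : Fin n) :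
    ∀ᵐ z ∂polydiscMeasure n, z i ∉ Metric.closedBall (0 : ℂ) R →
      coordOp discMeasure (cauchyKernel ψ) j (F j) z = 0 := by
  rcases eq_or_ne i j with rfl | hne
  · refine .of_forall fun z hz => ?_
    simp [coordOp, cauchyKernel, hψ.eq_zero (z i) (by simpa using hz)]
  · exact coordOp_ae_eq_zero_of_ne (polydiscMeasure_eq_pi n) j hne
      (hF.support hψ hsupp hρR j.2.le i)

include hψ hF hsupp in
theorem hasVanishingMoments (hρ : 0 ≤ ρ) (hρs : ρ < s) (hs1 : s < 1)
    (h0 : HasVanishingMoments 0 (F 0)) {m : ℕ} (hm : m ≤ n) : HasVanishingMoments m (F m) := by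
  induction m with
  | zero => exact h0
  | succ m ih =>
    exact ((ih (by omega)).coordOp_succ hψ hρ hρs hs1 hm (hF.integrable m)
      (hF.support_of_le hsupp (by omega) _ le_rfl)).congr_ae (hF.succ m hm)

include hψ hF hsupp in
theorem integral_mul_eq_sub_sum (hρs : ρ < s) (hR : R < 1) {φ : (Fin n → ℂ) → ℂ}
    (hφ : ContDiff ℝ 1 φ) (hφs : HasCompactSupport φ) {m : ℕ} (hm : m ≤ n) :
    ∫ z, F 0 z * φ z ∂polydiscMeasure n = ∫ z, F m z * φ z ∂polydiscMeasure n -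
      ∑ i ∈ Finset.range m, if h : i < n then
        ∫ z, coordOp discMeasure (cauchyKernel ψ) ⟨i, h⟩ (F i) z * coordBar ⟨i, h⟩ φ z
          ∂polydiscMeasure n else 0 := by
  induction m with
  | zero => simp
  | succ m ih =>
    rw [ih (by omega), Finset.sum_range_succ, dif_pos (show m < n from hm),
      integral_mul_eq_sub hψ hR hφ hφs ⟨m, hm⟩ (hF.integrable m)
        ((hF.support_of_le hsupp (by omega) ⟨m, hm⟩ le_rfl).mono fun z hz h => hz fun h1 =>
          h (Metric.closedBall_subset_closedBall hρs.le h1)),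
      integral_congr_ae (g := fun z => F (m + 1) z * φ z)
        ((hF.succ m hm).mono fun z hz => by simp only [hz])]
    ring

include hψ hF hsupp in
/-- If all the moments of `F 0` vanish, then `F 0` is the sum of the `∂/∂z̄_i` derivatives of the
functions obtained from the `F i` by the truncated Cauchy transform. -/
theorem integral_mul_eq_neg_sum (hρ : 0 ≤ ρ) (hρs : ρ < s) (hs1 : s < 1) (hR : R < 1)
    (h0 : HasVanishingMoments 0 (F 0)) {φ : (Fin n → ℂ) → ℂ}
    (hφ : ContDiff ℝ 1 φ) (hφs : HasCompactSupport φ) :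
    ∫ z, F 0 z * φ z ∂polydiscMeasure n = -∑ i : Fin n,
      ∫ z, coordOp discMeasure (cauchyKernel ψ) i (F i) z * coordBar i φ z ∂polydiscMeasure n := by
  obtain ⟨M, hM⟩ := hφ.continuous.bounded_above_of_compact_support hφs
  rw [hF.integral_mul_eq_sub_sum hψ hsupp hρs hR hφ hφs le_rfl,
    (hF.hasVanishingMoments hψ hsupp hρ hρs hs1 h0 le_rfl).integral_mul_eq_zero
      hφ.continuous.measurable hM, Finset.sum_range, zero_sub]
  simp

end IsIteration

/-! ### The iterates as bounded operators on `L^r`. -/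

section Solution

variable {b : ℂ → ℂ → ℂ} {C : NNReal} (hb : IsSchurKernel discMeasure b C)
  (r : ℝ≥0∞) [Fact (1 ≤ r)]

/-- The composition of the operators with kernel `b` in the first `m` coordinates. -/
def iterateLp : ℕ → Lp ℂ r (polydiscMeasure n) →L[ℂ] Lp ℂ r (polydiscMeasure n)
  | 0 => ContinuousLinearMap.id ℂ _
  | m + 1 => if h : m < n then (coordOpLp (polydiscMeasure_eq_pi n) hb ⟨m, h⟩ r).comp (iterateLp m)
      else iterateLp m

theorem isIteration_iterateLp (f : Lp ℂ r (polydiscMeasure n)) :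
    IsIteration b fun m => (iterateLp hb r m f : (Fin n → ℂ) → ℂ) where
  integrable m := integrable_of_memLp (polydiscMeasure_eq_pi n) Fact.out (Lp.memLp _)
  succ m h := by
    simp only [iterateLp, dif_pos h]
    exact coordOpLp_coeFn (polydiscMeasure_eq_pi n) hb ⟨m, h⟩ r _

theorem norm_iterateLp_le (f : Lp ℂ r (polydiscMeasure n)) {m : ℕ} (hm : m ≤ n) :
    ‖iterateLp hb r m f‖ ≤ (max 1 C : NNReal) ^ n * ‖f‖ := by
  -- Replacing `C` by `max 1 C` makes the bounds increase with `m`, so the exponent `n` serves for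
  -- all stages.
  have h : ∀ m, ‖iterateLp hb r m f‖ ≤ (max 1 C : NNReal) ^ m * ‖f‖ := fun m => by
    induction m with
    | zero => simp [iterateLp]
    | succ m ih =>
      have h1 : (1 : ℝ) ≤ (max 1 C : NNReal) := by exact_mod_cast le_max_left 1 C
      have h2 : (C : ℝ) ≤ (max 1 C : NNReal) := by exact_mod_cast le_max_right 1 C
      rw [iterateLp]
      split_ifs with hm
      · calc _ ≤ C * ‖iterateLp hb r m f‖ := 
              norm_coordOpLp_le (polydiscMeasure_eq_pi n) hb ⟨m, hm⟩ r _
          _ ≤ (max 1 C : NNReal) * ((max 1 C : NNReal) ^ m * ‖f‖) := by gcongr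
          _ = _ := by ring
      · refine ih.trans ?_
        gcongr
        exact m.le_succ
  refine (h m).trans ?_
  gcongr
  exact_mod_cast le_max_left 1 C

end Solution

/-! ### Forms of degrees `q` and `q + 1` in dimension `q + 1`, and the solution operator. -/

theorem MultiIndex.exists_eq_erase (J : MultiIndex (q + 1) q) :
    ∃ k : Fin (q + 1), J.1 = Finset.univ.erase k := by
  have h : (J.1ᶜ).card = 1 := by
    rw [Finset.card_compl, J.2, Fintype.card_fin]; omega
  obtain ⟨k, hk⟩ := Finset.card_eq_one.1 h
  exact ⟨k, by rw [← compl_compl J.1, hk, Finset.compl_singleton]⟩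

/-- The index which does not occur in `J`. -/
def MultiIndex.missing (J : MultiIndex (q + 1) q) : Fin (q + 1) := J.exists_eq_erase.choose

theorem MultiIndex.missing_erase (I : MultiIndex (q + 1) (q + 1)) (k : Fin (q + 1))
    (hk : k ∈ I.1) : (I.erase k hk).missing = k := by
  have h : I.1 = Finset.univ := (Finset.card_eq_iff_eq_univ _).1 (by rw [I.2, Fintype.card_fin])
  have h1 : (I.erase k hk).1 = Finset.univ.erase (I.erase k hk).missing :=
    (I.erase k hk).exists_eq_erase.choose_spec
  have h2 : (I.erase k hk).1 = Finset.univ.erase k := by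
    change I.1.erase k = _
    rw [h]
  by_contra hne
  have h3 : k ∈ Finset.univ.erase (I.erase k hk).missing :=
    Finset.mem_erase.2 ⟨Ne.symm hne, Finset.mem_univ _⟩
  rw [← h1, h2] at h3
  simp at h3

/-- The multi-index of all coordinates. -/
def MultiIndex.full (n : ℕ) : MultiIndex n n := ⟨Finset.univ, by simp⟩

theorem MultiIndex.eq_full (I : MultiIndex n n) : I = MultiIndex.full n :=
  Subtype.ext ((Finset.card_eq_iff_eq_univ _).1 (by rw [I.2, Fintype.card_fin]))

/-- The sign with which `dz̄_k ∧ dz̄_J`, `k ∉ J`, is the form of top degree. -/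
def coordSign (k : Fin n) : ℂ := (-1) ^ ((Finset.univ : Finset (Fin n)).filter (· < k)).card

theorem coordSign_mul_self (k : Fin n) : coordSign k * coordSign k = 1 := by
  rw [coordSign, ← mul_pow]; simp

theorem norm_coordSign (k : Fin n) : ‖coordSign k‖ = 1 := by simp [coordSign]

/-- The solution operator of the equation `∂̄η = ω` built from the kernels `a` and `b`. -/
def solutionOp {a b : ℂ → ℂ → ℂ} {Ca Cb : NNReal} (ha : IsSchurKernel discMeasure a Ca)
    (hb : IsSchurKernel discMeasure b Cb) (r : ℝ≥0∞) [Fact (1 ≤ r)] :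
    LpForm (polydisc (q + 1)) (q + 1) r →ₗ[ℂ] LpForm (polydisc (q + 1)) q r :=
  -- The coefficient at the multi-index omitting `j` is `A_j F_j`, with the sign that compensates
  -- the one in `dbar`.
  LinearMap.pi fun J => coordSign J.missing •
    ((coordOpLp (polydiscMeasure_eq_pi (q + 1)) ha J.missing r).comp
      (iterateLp hb r J.missing)).toLinearMap ∘ₗ LinearMap.proj (MultiIndex.full (q + 1))

theorem solutionOp_apply {a b : ℂ → ℂ → ℂ} {Ca Cb : NNReal} (ha : IsSchurKernel discMeasure a Ca)
    (hb : IsSchurKernel discMeasure b Cb) (r : ℝ≥0∞) [Fact (1 ≤ r)]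
    (ω : LpForm (polydisc (q + 1)) (q + 1) r) (J : MultiIndex (q + 1) q) :
    solutionOp ha hb r ω J = coordSign J.missing •
      coordOpLp (polydiscMeasure_eq_pi (q + 1)) ha J.missing r
        (iterateLp hb r J.missing (ω (MultiIndex.full (q + 1)))) := rfl

theorem solutionOp_ae {a b : ℂ → ℂ → ℂ} {Ca Cb : NNReal} (ha : IsSchurKernel discMeasure a Ca)
    (hb : IsSchurKernel discMeasure b Cb) (r : ℝ≥0∞) [Fact (1 ≤ r)]
    (ω : LpForm (polydisc (q + 1)) (q + 1) r) (J : MultiIndex (q + 1) q) :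
    ∀ᵐ z ∂polydiscMeasure (q + 1), solutionOp ha hb r ω J z = coordSign J.missing *
      coordOp discMeasure a J.missing
        (iterateLp hb r J.missing (ω (MultiIndex.full (q + 1)))) z := by
  rw [solutionOp_apply]
  filter_upwards [Lp.coeFn_smul (coordSign J.missing)
    (coordOpLp (polydiscMeasure_eq_pi (q + 1)) ha J.missing r
        (iterateLp hb r J.missing (ω (MultiIndex.full (q + 1))))),
    coordOpLp_coeFn (polydiscMeasure_eq_pi (q + 1)) ha J.missing r
        (iterateLp hb r J.missing (ω (MultiIndex.full (q + 1))))] with z h1 h2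
  rw [h1, Pi.smul_apply, h2, smul_eq_mul]

theorem norm_solutionOp_le {a b : ℂ → ℂ → ℂ} {Ca Cb : NNReal} (ha : IsSchurKernel discMeasure a Ca)
    (hb : IsSchurKernel discMeasure b Cb) (r : ℝ≥0∞) [Fact (1 ≤ r)]
    (ω : LpForm (polydisc (q + 1)) (q + 1) r) :
    ‖solutionOp ha hb r ω‖ ≤ Ca * (max 1 Cb : NNReal) ^ (q + 1) * ‖ω‖ := by
  refine (pi_norm_le_iff_of_nonneg (by positivity)).2 fun J => ?_
  rw [solutionOp_apply, norm_smul, norm_coordSign, one_mul, mul_assoc]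
  refine (norm_coordOpLp_le _ ha _ r _).trans ?_
  gcongr
  refine (norm_iterateLp_le hb r _ J.missing.2.le).trans ?_
  gcongr
  exact norm_le_pi_norm ω _

theorem dbarCoord_distribution {r : ℝ≥0∞} [Fact (1 ≤ r)] (k : Fin n)
    (η : LpForm (polydisc n) q r) (J : MultiIndex n q) (φ : 𝓓(polydisc n, ℝ)) :
    dbarCoord (polydisc n) k (LpForm.toCurrent (polydisc n) q r η J) φ =
      -∫ z, η J z * coordBar k (fun z => (φ z : ℂ)) z ∂polydiscMeasure n := by
  have hi : ∀ φ : 𝓓(polydisc n, ℝ), Integrable (fun z => (φ z : ℂ) * η J z)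
      (polydiscMeasure n) := fun φ => by
    simpa using TestFunction.integrable_bilin (ContinuousLinearMap.lsmul ℝ ℝ)
        ((locallyIntegrable_Lp (polydisc n) r (η J)).locallyIntegrableOn _) φ
  rw [dbarCoord_apply, toCurrent_apply, toCurrent_apply, ← integral_const_mul,
    ← integral_add (hi _) ((hi _).const_mul _), neg_mul, ← integral_const_mul]
  congr 2
  ext z
  have hφ : ∀ v, fderiv ℝ (fun z => (φ z : ℂ)) z v = (fderiv ℝ φ z v : ℂ) := fun v => by
    have h := (φ.contDiff.differentiable (by simp) z).hasFDerivAt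
    exact congrArg (fun L => L v) (Complex.ofRealCLM.hasFDerivAt.comp z h).fderiv
  rw [lineDerivOp_testFunction_apply, lineDerivOp_testFunction_apply, coordBar, hφ, hφ]
  ring

theorem exists_norm_le_of_subset_polydisc {K : Set (Fin n → ℂ)} (hK : IsCompact K)
    (hKΩ : K ⊆ polydisc n) : ∃ ρ : ℝ, 0 ≤ ρ ∧ ρ < 1 ∧ ∀ z ∈ K, ∀ i, ‖z i‖ ≤ ρ := by
  rcases K.eq_empty_or_nonempty with rfl | hne
  · exact ⟨0, le_rfl, one_pos, by simp⟩
  · obtain ⟨z, hz, hmax⟩ := hK.exists_isMaxOn hne continuous_norm.continuousOn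
    refine ⟨‖z‖, norm_nonneg _, (pi_norm_lt_iff one_pos).2 (hKΩ hz), fun w hw i => ?_⟩
    exact (norm_le_pi_norm w i).trans (hmax hw)

theorem exists_solution_operator (q : ℕ) {K : Set (Fin (q + 1) → ℂ)} (hK : IsCompact K)
    (hKΩ : K ⊆ polydisc (q + 1)) :
    ∃ K' : Set (Fin (q + 1) → ℂ), IsCompact K' ∧ K' ⊆ polydisc (q + 1) ∧
      ∃ C : ℝ, ∀ (r : ℝ≥0∞) [Fact (1 ≤ r)],
      ∃ S : solvableData (polydisc (q + 1)) q r K →ₗ[ℂ] LpForm (polydisc (q + 1)) q r,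
        ∀ ω : solvableData (polydisc (q + 1)) q r K,
          S ω ∈ LpForm.supportedIn (polydisc (q + 1)) q r K' ∧
          dbar (polydisc (q + 1)) q (LpForm.toCurrent (polydisc (q + 1)) q r (S ω)) =
            LpForm.toCurrent (polydisc (q + 1)) (q + 1) r ω ∧
          ‖S ω‖ ≤ C * ‖ω‖ := by
  obtain ⟨ρ, hρ, hρ1, hKρ⟩ := exists_norm_le_of_subset_polydisc hK hKΩ
  -- The gap between `ρ` and `s` makes the kernel expansion converge, the one between `s` and `R`
  -- leaves room for the cutoff, and `R < 1` keeps the solution compactly supported. All these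
  -- choices, hence `K'` and the constant, precede `r` and `ω`.
  obtain ⟨s, hρs, hs1⟩ := exists_between hρ1
  obtain ⟨R, hsR, hR⟩ := exists_between hs1
  obtain ⟨ψ, hψ⟩ := exists_isCutoff (hρ.trans_lt hρs) hsR
  obtain ⟨Ca, ha⟩ :=
    exists_isSchurKernel_cauchyKernel hψ.contDiff.continuous hψ.hasCompactSupport
  obtain ⟨Cb, hb⟩ := exists_isSchurKernel_cauchyKernel (continuous_wirtingerBar hψ.contDiff).neg
    (hasCompactSupport_wirtingerBar hψ.hasCompactSupport).neg
  refine ⟨univ.pi fun _ => Metric.closedBall 0 R, isCompact_univ_pi fun _ => isCompact_closedBall _ _,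
    fun z hz i => (mem_closedBall_zero_iff.1 (hz i (mem_univ i))).trans_lt hR,
    Ca * (max 1 Cb : NNReal) ^ (q + 1), fun r _ =>
    ⟨solutionOp ha hb r ∘ₗ Submodule.subtype _, ?_⟩⟩
  rintro ⟨ω, hω, T, hT, hTω⟩
  set F : ℕ → (Fin (q + 1) → ℂ) → ℂ := fun m =>
    (iterateLp hb r m (ω (MultiIndex.full (q + 1))) : (Fin (q + 1) → ℂ) → ℂ) with hFdef
  have hF : IsIteration (cauchyKernel (-wirtingerBar ψ)) F := isIteration_iterateLp hb r _
  have hsupp : ∀ i, ∀ᵐ z ∂polydiscMeasure (q + 1),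
      z i ∉ Metric.closedBall (0 : ℂ) ρ → F 0 z = 0 := fun i =>
    (hω (MultiIndex.full (q + 1))).mono fun z hz h =>
      hz fun hzK => h (mem_closedBall_zero_iff.2 (hKρ z hzK i))
  -- The only place where the existence of `T` is used.
  have h0 : HasVanishingMoments 0 (F 0) := hasVanishingMoments_zero fun g hg hgc =>
    integral_mul_holomorphic_eq_zero hK hKΩ hω hT hTω hg hgc _
  refine ⟨fun J => ?_, ?_, norm_solutionOp_le ha hb r ω⟩
  · have h1 := ae_all_iff.2 (hF.coordOp_support hψ hsupp (hρs.trans hsR).le J.missing)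
    filter_upwards [h1, solutionOp_ae ha hb r ω J] with z h1 h2 hz
    rw [mem_univ_pi, not_forall] at hz
    obtain ⟨i, hi⟩ := hz
    change solutionOp ha hb r ω J z = 0
    rw [h2, h1 i hi, mul_zero]
  · funext I
    rw [MultiIndex.eq_full I]
    ext φ
    rw [dbar_apply, toCurrent_apply]
    have hφ : ContDiff ℝ 1 fun z => (φ z : ℂ) :=
      Complex.ofRealCLM.contDiff.comp (φ.contDiff.of_le (by simp))
    have hφs : HasCompactSupport fun z => (φ z : ℂ) :=
      φ.hasCompactSupport.comp_left (g := fun x : ℝ => (x : ℂ)) rfl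
    have key := hF.integral_mul_eq_neg_sum hψ hsupp hρ hρs hs1 hR h0 hφ hφs
    calc _ = ∑ k : {k // k ∈ (MultiIndex.full (q + 1)).1},
          -∫ z, coordOp discMeasure (cauchyKernel ψ) k.1 (F k.1) z *
            coordBar k.1 (fun z => (φ z : ℂ)) z ∂polydiscMeasure (q + 1) := by
          refine Finset.sum_congr rfl fun k _ => ?_
          rw [dbarCoord_distribution, mul_neg, ← integral_const_mul]
          congr 1
          refine integral_congr_ae ?_
          filter_upwards [solutionOp_ae ha hb r ω ((MultiIndex.full (q + 1)).erase k.1 k.2)]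
            with z hz
          rw [MultiIndex.missing_erase] at hz
          change coordSign k.1 * (solutionOp ha hb r ω _ z * _) = _
          rw [hz]
          linear_combination (coordOp discMeasure (cauchyKernel ψ) k.1 (F k.1) z *
            coordBar k.1 (fun z => (φ z : ℂ)) z) * coordSign_mul_self k.1
      _ = -∑ i : Fin (q + 1), ∫ z, coordOp discMeasure (cauchyKernel ψ) i (F i) z *
            coordBar i (fun z => (φ z : ℂ)) z ∂polydiscMeasure (q + 1) := by
          rw [← Finset.sum_neg_distrib]
          exact (Finset.sum_subtype (p := (· ∈ (MultiIndex.full (q + 1)).1)) Finset.univ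
            (fun i => by simp [MultiIndex.full]) fun i : Fin (q + 1) =>
              -∫ z, coordOp discMeasure (cauchyKernel ψ) i (F i) z *
                coordBar i (fun z => (φ z : ℂ)) z ∂polydiscMeasure (q + 1)).symm
      _ = _ := by
          rw [← key]
          refine integral_congr_ae (.of_forall fun z => ?_)
          exact mul_comm _ _

end DbarPolydisc

end

-- Writing `n = q + 1` encodes `n ≥ 1` and gives the degree `n - 1` without subtraction. The first
-- assertion is the second one applied to a compact set off which `ω` vanishes.
open DbarPolydisc in
theorem mainTheorem3 (n q : ℕ) (hn : n = q + 1) :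
    (∀ (r : ℝ≥0∞) [Fact (1 ≤ r)] (ω : LpForm (polydisc n) (q + 1) r), ω.HasCompactSupport →
      (∃ T : Current (polydisc n) q, T.HasCompactSupport ∧
        dbar (polydisc n) q T = LpForm.toCurrent (polydisc n) (q + 1) r ω) →
      ∃ η : LpForm (polydisc n) q r, η.HasCompactSupport ∧
        dbar (polydisc n) q (LpForm.toCurrent (polydisc n) q r η) =
          LpForm.toCurrent (polydisc n) (q + 1) r ω) ∧
    (∀ K : Set (Fin n → ℂ), IsCompact K → K ⊆ polydisc n →
      ∃ K' : Set (Fin n → ℂ), IsCompact K' ∧ K' ⊆ polydisc n ∧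
      ∃ C : ℝ, ∀ (r : ℝ≥0∞) [Fact (1 ≤ r)],
      ∃ S : solvableData (polydisc n) q r K →ₗ[ℂ] LpForm (polydisc n) q r,
        ∀ ω : solvableData (polydisc n) q r K,
          S ω ∈ LpForm.supportedIn (polydisc n) q r K' ∧
          dbar (polydisc n) q (LpForm.toCurrent (polydisc n) q r (S ω)) =
            LpForm.toCurrent (polydisc n) (q + 1) r ω ∧
          ‖S ω‖ ≤ C * ‖ω‖) := by
  subst hn
  refine ⟨fun r _ ω hω hT => ?_, fun K hK hKΩ => exists_solution_operator q hK hKΩ⟩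
  obtain ⟨K, hK, hKΩ, hωK⟩ := hω
  obtain ⟨K', hK', hKΩ', C, h⟩ := exists_solution_operator q hK hKΩ
  obtain ⟨S, hS⟩ := h r
  obtain ⟨h1, h2, -⟩ := hS ⟨ω, hωK, hT⟩
  exact ⟨_, ⟨K', hK', hKΩ', h1⟩, h2⟩
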